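/- Let $\mathbb K$ be a field, $I\subset\mathbb K[x_1,\dots,x_n]$ ($n\ge 1$) a zero-dimensional ideal of degree $D=\dim_{\mathbb K}\mathbb K[x_1,\dots,x_n]/I$, invariant under the action $f(\mathbf x)\mapsto f(A\mathbf x)$ of the elements $A$ of a finite group $G\subset \mathrm{GL}_n(\mathbb K)$ of diagonal matrices. Let $\mathcal T$ be the set of monomials, let $\mathcal T[\Lambda_+]$ be the set of monomials of $G$-degree $0$ (those fixed by every element of $G$), and for $A,B\subseteq\mathcal T$ let $A+B=\{ab : a\in A,\ b\in B\}$. Let $\mathcal G$ be the reduced Gröbner basis of $I$ for $\mathrm{LEX}(x_n\prec\cdots\prec x_1)$ and $S$ its staircase (the monomials divisible by no leading monomial of $\mathcal G$); let $\mathcal G_{\mathrm{DRL}}$ be the reduced Gröbner basis of $I$ for $\mathrm{DRL}(x_n\prec\cdots\prec x_1)$ and $E$ its staircase, so $\# E=D$. Assume: - Property S (shape position): $\mathcal G=\{x_n^D+g_n(x_n),\,x_{n-1}+g_{n-1}(x_n),\dots,x_1+g_1(x_n)\}$ with $g_1,\dots,g_n\in\mathbb K[x_n]$ of degree at most $D-1$;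 - Property M: for every $m\in E$, either $m x_n\in E$ or $m x_n$ is the leading monomial of an element of $\mathcal G_{\mathrm{DRL}}$; - the matrix $M_n$ of the multiplication by $x_n$ in the basis $E$ of $\mathbb K[x_1,\dots,x_n]/I$ has $k$ nontrivial columns, that is, $k=\#\{m\in E: m x_n\notin E\}$; - the staircase is evenly split with respect to $G$: $\#(S\cap\mathcal T[\Lambda_+])\le c\,D/|G|$ for a constant $c$. For a vector $\mathbf r\in\mathbb K^E$, let $\mathbf u=(u_m)_{m\in\mathcal T}$ be the table with $u_m=r_m$ for $m\in E$ and whose other terms are determined by requiring that the elements of $\mathcal G_{\mathrm{DRL}}$ be linear recurrence relations with constant coefficients on $\mathbf u$ (that is, $\sum_s f_s u_{s m}=0$ for every $f=\sum_s f_s s\in\mathcal G_{\mathrm{DRL}}$ and every $m\in\mathcal T$). Then, for $\mathbf r$ picked at random, the LEX basis $\mathcal G$ can be recovered from the DRL one using at most $$\#\Big((S\cap\mathcal T[\Lambda_+])+\big((S\cap\mathcal T[\Lambda_+])\cup \mathrm{LM}(\mathcal G)\big)\Big)$$ terms of the table $\mathbf u$ and $O(n k D^2/|G|)$ operations in $\mathbb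 K$, where the implied constant depends only on $c$. Precisely: there is a constant $C$ depending only on $c$ such that for every $n$, $D$, $E$ and every partition of the monomials into $G$-degrees there are a finite set $Q$ of monomials and an algorithm (an algebraic computation tree: constants $0$ and $1$, field operations and zero tests, not depending on $\mathbb K$ or on the coefficients of the polynomials) that has the following properties for all $\mathbb K,G,I$ as above with these data. The cardinality of $Q$ is at most the number displayed above, and the number of operations of the algorithm, in the worst case, is at most $C\,n k D^2/|G|$. A first part of the algorithm computes, from the coefficients of $\mathcal G_{\mathrm{DRL}}$ and from any $\mathbf r\in\mathbb K^E$, the table terms $(u_q)_{q\in Q}$. A second part has these table terms as its only input, and there is a polynomial $F$ in $D$ variables over $\mathbb K$, of degree at most $D$ and not vanishing identically on $\mathbb K^E$, such that this second part returns the coefficients of $g_1,\dots,g_n$, hence $\mathcal G$, whenever $F(\mathbf r)\neq 0$. -/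

import Mathlib

open scoped Pointwise

noncomputable section

/-! ### The two monomial orders

Monomials in the variables `x_1, …, x_n` are exponent vectors `Fin n →₀ ℕ`; the variable `x_p` has
index `p - 1`.  `LEX(x_n ≺ ⋯ ≺ x_1)` is Mathlib's `MonomialOrder.lex`.  `DRL(x_n ≺ ⋯ ≺ x_1)`, the
degree reverse lexicographic order, is built here. -/

/-- Type synonym for exponent vectors, ordered by the degree reverse lexicographic order. -/
def DegRevLex (n : ℕ) : Type := Fin n →₀ ℕ

namespace DegRevLex

variable {n : ℕ}

instance : AddCommMonoid (DegRevLex n) := inferInstanceAs (AddCommMonoid (Fin n →₀ ℕ))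

/-- The identity map from exponent vectors to the type synonym. -/
def of : (Fin n →₀ ℕ) ≃+ DegRevLex n where
  toFun s := s
  invFun s := s
  left_inv _ := rfl
  right_inv _ := rfl
  map_add' _ _ := rfl

/-- Monomials are compared first by total degree, then by the *reverse* of the lexicographic
comparison of the exponents read from the last variable to the first one. -/
def key (s : DegRevLex n) : ℕ ×ₗ (Lex (Fin n → ℕ))ᵒᵈ :=
  toLex (Finsupp.degree (of.symm s),
    OrderDual.toDual (toLex fun q : Fin n => of.symm s q.rev))

theorem key_injective : Function.Injective (key (n := n)) := by
  intro s t h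
  have h2 : (fun q : Fin n => of.symm s q.rev) = fun q : Fin n => of.symm t q.rev :=
    congrArg (fun z : ℕ ×ₗ (Lex (Fin n → ℕ))ᵒᵈ => ofLex (OrderDual.ofDual (ofLex z).2)) h
  refine of.symm.injective (Finsupp.ext fun q => ?_)
  simpa using congrFun h2 q.rev

instance : LinearOrder (DegRevLex n) := LinearOrder.lift' key key_injective

/-- The defining property of the order: `x^s ≺ x^t` if and only if `deg s < deg t`, or the degrees
agree and at the last place `p` where the exponents differ one has `s_p > t_p`. -/
theorem lt_iff (s t : Fin n →₀ ℕ) :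
    of s < of t ↔
      s.degree < t.degree ∨
        (s.degree = t.degree ∧ ∃ p, (∀ q, p < q → s q = t q) ∧ t p < s p) := by
  change key _ < key _ ↔ _
  unfold key
  rw [Prod.Lex.toLex_lt_toLex]
  refine or_congr Iff.rfl (and_congr Iff.rfl ?_)
  rw [OrderDual.toDual_lt_toDual]
  change (∃ i : Fin n, (∀ j, j < i → t j.rev = s j.rev) ∧ t i.rev < s i.rev) ↔ _
  constructor
  · rintro ⟨i, h1, h2⟩
    refine ⟨i.rev, fun q hq => ?_, h2⟩
    simpa using (h1 q.rev (by rw [Fin.rev_lt_iff]; exact hq)).symm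
  · rintro ⟨p, h1, h2⟩
    refine ⟨p.rev, fun j hj => ?_, by simpa using h2⟩
    exact (h1 j.rev (by rw [Fin.lt_rev_iff]; exact hj)).symm

theorem of_mono {s t : Fin n →₀ ℕ} (h : s ≤ t) : of s ≤ of t := by
  rcases h.eq_or_lt with h | h
  · rw [h]
  · refine le_of_lt ((lt_iff s t).2 (Or.inl ?_))
    have hne : t - s ≠ 0 := fun h0 => absurd h (not_lt_of_ge (tsub_eq_zero_iff_le.1 h0))
    have h1 : t.degree = s.degree + (t - s).degree := by
      rw [← map_add, add_tsub_cancel_of_le h.le]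
    have h2 : (t - s).degree ≠ 0 := fun h0 => hne ((Finsupp.degree_eq_zero_iff _).1 h0)
    omega

instance : IsOrderedAddMonoid (DegRevLex n) where
  add_le_add_left a b h c := by
    rcases h.eq_or_lt with h | h
    · rw [h]
    · have key : of (of.symm a + of.symm c) < of (of.symm b + of.symm c) := by
        have h' := (lt_iff (of.symm a) (of.symm b)).1 (by simpa using h)
        rw [lt_iff]
        simpa [map_add] using h'
      simpa using key.le

instance : WellFoundedLT (DegRevLex n) := by
  have hw : WellQuasiOrdered ((· ≤ ·) : DegRevLex n → DegRevLex n → Prop) := by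
    intro f
    obtain ⟨i, j, hij, h⟩ := (wellQuasiOrdered_le (α := Fin n →₀ ℕ)) fun i => of.symm (f i)
    exact ⟨i, j, hij, by simpa using of_mono h⟩
  have : WellQuasiOrderedLE (DegRevLex n) := ⟨hw⟩
  infer_instance

end DegRevLex

/-- `DRL(x_n ≺ ⋯ ≺ x_1)` as a Mathlib monomial order. -/
def drl (n : ℕ) : MonomialOrder (Fin n) where
  syn := DegRevLex n
  toSyn := DegRevLex.of
  toSyn_monotone := fun _ _ h => DegRevLex.of_mono h

/-! ### Gröbner bases, staircases and zero-dimensional ideals -/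

section Groebner

variable {n : ℕ} {K : Type*} [Field K]

/-- `𝒢` is the reduced Gröbner basis of `I` for the monomial order `m`: its elements are monic and
lie in `I`, the leading monomial of every nonzero element of `I` is divisible by that of an element
of `𝒢`, and no monomial of an element of `𝒢` is divisible by the leading monomial of another one. -/
def IsReducedGroebnerBasis (m : MonomialOrder (Fin n)) (I : Ideal (MvPolynomial (Fin n) K))
    (𝒢 : Set (MvPolynomial (Fin n) K)) : Prop :=
  (∀ g ∈ 𝒢, g ∈ I ∧ m.Monic g) ∧
  (∀ f ∈ I, f ≠ 0 → ∃ g ∈ 𝒢, m.degree g ≤ m.degree f) ∧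
  (∀ g ∈ 𝒢, ∀ g' ∈ 𝒢, g ≠ g' → ∀ s ∈ g'.support, ¬ m.degree g ≤ s)

/-- The set of the leading monomials of the elements of `𝒢`. -/
def leadingMonomials (m : MonomialOrder (Fin n)) (𝒢 : Set (MvPolynomial (Fin n) K)) :
    Set (Fin n →₀ ℕ) :=
  m.degree '' 𝒢

/-- The staircase of `𝒢`: the monomials divisible by no leading monomial of `𝒢`. -/
def staircase (m : MonomialOrder (Fin n)) (𝒢 : Set (MvPolynomial (Fin n) K)) :
    Set (Fin n →₀ ℕ) :=
  {s | ∀ g ∈ 𝒢, ¬ m.degree g ≤ s}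

/-- A zero-dimensional ideal: a proper ideal with finite-dimensional quotient. -/
def IsZeroDimensional (I : Ideal (MvPolynomial (Fin n) K)) : Prop :=
  I ≠ ⊤ ∧ Module.Finite K (MvPolynomial (Fin n) K ⧸ I)

/-- The degree of a zero-dimensional ideal. -/
def idealDegree (I : Ideal (MvPolynomial (Fin n) K)) : ℕ :=
  Module.finrank K (MvPolynomial (Fin n) K ⧸ I)

/-- The polynomial `x_{n+1}^a + ∑_{j < D} c_j x_{n+1}^j` if `i` is the last variable (with `a = D`),
and `x_i + ∑_{j < D} c_j x_{n+1}^j` otherwise. -/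
def shapePolynomial (D : ℕ) (i : Fin (n + 1)) (c : Fin D → K) : MvPolynomial (Fin (n + 1)) K :=
  MvPolynomial.X i ^ (if i = Fin.last n then D else 1)
    + ∑ j : Fin D, MvPolynomial.C (c j) * MvPolynomial.X (Fin.last n) ^ (j : ℕ)

/-- The set of polynomials in shape position with coefficients `c`. -/
def shapeBasis (D : ℕ) (c : Fin (n + 1) → Fin D → K) : Set (MvPolynomial (Fin (n + 1)) K) :=
  Set.range fun i => shapePolynomial D i (c i)

/-- Property S, for the reduced `LEX` Gröbner basis `ℋ` of an ideal of degree `D`. -/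
def PropertyS (D : ℕ) (ℋ : Set (MvPolynomial (Fin (n + 1)) K)) : Prop :=
  ∃ c : Fin (n + 1) → Fin D → K, ℋ = shapeBasis D c

/-- Property M, for the reduced `DRL` Gröbner basis `𝒢`: for each monomial `x^s` of the staircase,
`x^s` times the last variable is in the staircase or is the leading monomial of an element of
`𝒢`. -/
def PropertyM (𝒢 : Set (MvPolynomial (Fin (n + 1)) K)) : Prop :=
  ∀ s ∈ staircase (drl (n + 1)) 𝒢,
    s + Finsupp.single (Fin.last n) 1 ∈ staircase (drl (n + 1)) 𝒢 ∨
    s + Finsupp.single (Fin.last n) 1 ∈ leadingMonomials (drl (n + 1)) 𝒢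

end Groebner

/-- Given the `DRL` staircase `E`, the labels of the non-trivial columns of the matrix of the
multiplication by the last variable in the basis `E` of the quotient: the column of `x^s` is trivial
when `x^s` times the last variable is again in the staircase. -/
def nontrivialColumns {n : ℕ} (E : Finset (Fin (n + 1) →₀ ℕ)) : Finset (Fin (n + 1) →₀ ℕ) :=
  open Classical in E.filter fun s => s + Finsupp.single (Fin.last n) 1 ∉ E

/-! ### Diagonal matrix groups -/

section Action

variable {n : ℕ} {K : Type*} [Field K]

/-- The action of a matrix on polynomials, `f(x) ↦ f(A x)`. -/
def matrixAct (A : GL (Fin n) K) : MvPolynomial (Fin n) K →ₐ[K] MvPolynomial (Fin n) K :=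
  MvPolynomial.aeval fun i => ∑ j, MvPolynomial.C ((A : Matrix (Fin n) (Fin n) K) i j)
    * MvPolynomial.X j

/-- `I` is invariant under the action of `G`. -/
def IsInvariantUnder (I : Ideal (MvPolynomial (Fin n) K)) (G : Subgroup (GL (Fin n) K)) : Prop :=
  ∀ A ∈ G, ∀ f ∈ I, matrixAct A f ∈ I

/-- The scalar by which a diagonal matrix `A` multiplies the monomial `x^s`. -/
def monomialWeight (A : GL (Fin n) K) (s : Fin n →₀ ℕ) : K :=
  ∏ i, (A : Matrix (Fin n) (Fin n) K) i i ^ s i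

/-- Two monomials have the same `G`-degree, `G` a group of diagonal matrices, if every element of
`G` multiplies them by the same scalar. -/
def SameGDegree (G : Subgroup (GL (Fin n) K)) (s t : Fin n →₀ ℕ) : Prop :=
  ∀ A ∈ G, monomialWeight A s = monomialWeight A t

/-- The set of monomials of `G`-degree zero (that is, of the `G`-degree of the monomial `1`). -/
def degreeZeroMonomials (G : Subgroup (GL (Fin n) K)) : Set (Fin n →₀ ℕ) :=
  {s | SameGDegree G s 0}

end Action

/-! ### Tables -/

section Tables

variable {n : ℕ} {K : Type*} [Field K]

/-- The bracket `[f]_u = ∑ f_s u_s` of a polynomial and a table. -/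
def tableBracket (u : (Fin n →₀ ℕ) → K) (f : MvPolynomial (Fin n) K) : K :=
  ∑ s ∈ f.support, f.coeff s * u s

/-- `f` is a linear recurrence relation with constant coefficients on the table `u`. -/
def IsCRelation (u : (Fin n →₀ ℕ) → K) (f : MvPolynomial (Fin n) K) : Prop :=
  ∀ i : Fin n →₀ ℕ, tableBracket u (f * MvPolynomial.monomial i 1) = 0

/-- `u` is the table built from the Gröbner basis `𝒢` with staircase `E` and the vector `r`: its
terms on the staircase are the entries of `r`, and all its other terms are determined by the
relations in `𝒢`. -/
def IsTableOf (𝒢 : Set (MvPolynomial (Fin n) K)) (E : Finset (Fin n →₀ ℕ)) (r : E → K)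
    (u : (Fin n →₀ ℕ) → K) : Prop :=
  (∀ e : E, u e = r e) ∧ ∀ g ∈ 𝒢, IsCRelation u g

end Tables

/-! ### Algebraic programs and their operation count -/

/-- The four binary operations of a field. -/
inductive ArithOp : Type
  | add
  | sub
  | mul
  | div

/-- The value of an operation (with `a / 0 = 0`). -/
def ArithOp.apply {K : Type*} [Field K] : ArithOp → K → K → K
  | .add, a, b => a + b
  | .sub, a, b => a - b
  | .mul, a, b => a * b
  | .div, a, b => a / b

/-- Algebraic computation trees.  A program has read-only input cells labelled by `ι` and working
cells labelled by natural numbers (initially `0`), which hold elements of a field.  It can write the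
constant `1` or the result of a field operation into a working cell, branch on whether a cell is
zero, and stop, announcing for each label in `o` the cell in which that output is found.  Field
elements are accessible in no other way, and a program mentions no field. -/
inductive ArithProgram (ι o : Type) : Type
  | ret (out : o → ι ⊕ ℕ)
  | one (dst : ℕ) (next : ArithProgram ι o)
  | op (f : ArithOp) (dst : ℕ) (a b : ι ⊕ ℕ) (next : ArithProgram ι o)
  | ifZero (a : ι ⊕ ℕ) (yes no : ArithProgram ι o)

namespace ArithProgram

variable {ι o : Type}

/-- Execution of a program over `K`, on an input and a state of the working cells. -/
def exec {K : Type*} [Field K] (input : ι → K) : ArithProgram ι o → (ℕ → K) → (o → K)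
  | ret out, mem => fun z => Sum.elim input mem (out z)
  | one dst next, mem => exec input next (Function.update mem dst 1)
  | op f dst a b next, mem =>
      exec input next
        (Function.update mem dst (f.apply (Sum.elim input mem a) (Sum.elim input mem b)))
  | ifZero a yes no, mem =>
      open Classical in
      if Sum.elim input mem a = 0 then exec input yes mem else exec input no mem

/-- The output of a program over `K` on an input. -/
def run {K : Type*} [Field K] (p : ArithProgram ι o) (input : ι → K) : o → K :=
  exec input p fun _ => 0

/-- The number of operations (constants, field operations and zero tests) of a program, in the worst
case over all inputs and all fields. -/
def cost : ArithProgram ι o → ℕ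
  | ret _ => 0
  | one _ next => cost next + 1
  | op _ _ _ _ next => cost next + 1
  | ifZero _ yes no => max (cost yes) (cost no) + 1

end ArithProgram

/-- A change of order algorithm through a table, for ideals of degree `D` in `n` variables with a
given `DRL` staircase `E`.  Its first part reads the coefficients of the reduced `DRL` Gröbner
basis and the vector `r`, and computes the terms of the table with indices in `terms`.  Its second
part sees nothing but these table terms, and computes for each of the `n` variables a vector of
`D` coefficients. -/
structure TableAlgorithm (n D : ℕ) (E : Finset (Fin n →₀ ℕ)) where
  /-- The indices of the table terms that are used. -/
  terms : Finset (Fin n →₀ ℕ)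
  /-- The computation of these table terms; input `(l, s)` is the coefficient of `x^s` in the
  basis element with leading monomial `x^l`, and input `e` is the entry `r_e`. -/
  tablePart : ArithProgram (((Fin n →₀ ℕ) × (Fin n →₀ ℕ)) ⊕ E) terms
  /-- The recovery of the output from the table terms. -/
  guessPart : ArithProgram terms (Fin n × Fin D)

/-- The total number of operations of the algorithm. -/
def TableAlgorithm.cost {n D : ℕ} {E : Finset (Fin n →₀ ℕ)} (alg : TableAlgorithm n D E) : ℕ :=
  alg.tablePart.cost + alg.guessPart.cost

/-- The coefficient of `x^s` in the element of `𝒢` with leading monomial `x^l` (`0` if there is no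
such element; there is at most one if `𝒢` is a reduced Gröbner basis). -/
def basisCoeff {n : ℕ} {K : Type*} [Field K] (m : MonomialOrder (Fin n))
    (𝒢 : Set (MvPolynomial (Fin n) K)) (l s : Fin n →₀ ℕ) : K :=
  open Classical in
  if h : ∃ g ∈ 𝒢, m.degree g = l then MvPolynomial.coeff s h.choose else 0

/-- The input of the first part of the algorithm. -/
def tableInput {n : ℕ} {K : Type*} [Field K] (𝒢 : Set (MvPolynomial (Fin n) K))
    (E : Finset (Fin n →₀ ℕ)) (r : E → K) : ((Fin n →₀ ℕ) × (Fin n →₀ ℕ)) ⊕ E → K :=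
  Sum.elim (fun z => basisCoeff (drl n) 𝒢 z.1 z.2) r

end

/-! Write x for the last variable, d for the least positive exponent such that x^d has degree zero
(`lastPeriod`), b for the remainder of D - 1 by d, and N for the number of multiples of d below D
(`zeroCount`), so that b + d(N - 1) = D - 1. In shape position the LEX staircase is 1, x, ...,
x^(D-1), and N is the number of its monomials of degree zero. If A is in G, f is in I and all
monomials of f but one, s₀, lie in a staircase, then f(A·) minus the weight of s₀ times f is an
element of I supported on that staircase, hence zero. So every element of either reduced basis is
homogeneous for the G-degree (`IsReducedGroebnerBasis.sameGDegree`), and so is every LEX normal form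
of a monomial. Hence each degree contains at most N monomials of E (`ShapeSetting.card_class_le`).

Recovery. Every table is that of a linear form on the quotient. Let w_j be the table term at
x^(b+dj). By homogeneity, x_i + g_i times a suitable power x^t with t < d involves, besides its
leading monomial, only the N monomials x^(b+dk), k < N; if no such t exists, then g_i = 0.
Multiplying further by x^(dl), l < N, gives a linear system for the coefficients with the N × N
Hankel matrix (w_(l+k)), the same for all i (`ShapeSetting.hankel_relation`). For x itself the
right-hand side consists of further terms w_j, so 2N + (n - 1)N table terms suffice for n variables;
the sumset in the statement contains as many distinct monomials
(`ShapeSetting.card_usedTerms_le_ncard`).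

Solving. A division-free Berlekamp–Massey algorithm yields in O(N²) operations the monic recurrence
of degree N and the last column of the inverse Hankel matrix (`BMCell.Inv.rel_spec`,
`BMCell.Inv.lastCol_spec`). Each further column follows from the preceding one in O(N) operations
(`sum_hankelInvCol`), and each right-hand side then costs a matrix-vector product, O(nN²) in all.

Table. The terms at s x^a, with s in E and in the degree of x^b, are computed for increasing a. If s
x is in E, the next term is known; otherwise s x is a leading monomial by Property M, and its basis
element has at most N further terms. Each of the D + dN rounds thus costs O(kN), and dN ≤ |G| N ≤
cD, so the total is O(kDN) = O(kD²/|G|) (`ShapeSetting.tableState_eq`, `ShapeSetting.cost_le`).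

Genericity. F is the determinant of the Hankel matrix whose entries are linear forms in r; its
degree is at most N ≤ D. It does not vanish at the coordinate form of x^(D-1) in the LEX basis, for
which the matrix is antitriangular (`ShapeSetting.exists_eval_hankelDet_ne_zero`). -/

noncomputable section

/-! ### Programs as uniformly computed functions -/

namespace ArithProgram

variable {ι o o' : Type}

/-- The address of a cell, when the working cells are moved to the even positions. -/
def evenAddr : ι ⊕ ℕ → ι ⊕ ℕ := Sum.map id (2 * ·)

/-- The address of a cell of a program whose inputs are the cells `out` (moved to the even
positions) and whose working cells are moved to the odd positions. -/
def oddAddr (out : o → ι ⊕ ℕ) : o ⊕ ℕ → ι ⊕ ℕ :=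
  Sum.elim (fun z => evenAddr (out z)) fun j => Sum.inr (2 * j + 1)

/-- The program `q`, reading its inputs from the cells `out`. -/
def reroute (out : o → ι ⊕ ℕ) : ArithProgram o o' → ArithProgram ι o'
  | ret out' => ret fun z => oddAddr out (out' z)
  | one dst next => one (2 * dst + 1) (reroute out next)
  | op f dst a b next => op f (2 * dst + 1) (oddAddr out a) (oddAddr out b) (reroute out next)
  | ifZero a yes no => ifZero (oddAddr out a) (reroute out yes) (reroute out no)

/-- Sequential composition: the outputs of the first program are the inputs of the second one. -/
def seq (q : ArithProgram o o') : ArithProgram ι o → ArithProgram ι o'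
  | ret out => reroute out q
  | one dst next => one (2 * dst) (seq q next)
  | op f dst a b next => op f (2 * dst) (evenAddr a) (evenAddr b) (seq q next)
  | ifZero a yes no => ifZero (evenAddr a) (seq q yes) (seq q no)

/-- The program that returns its inputs together with the outputs of `p`. -/
def keep : ArithProgram ι o → ArithProgram ι (ι ⊕ o)
  | ret out => ret (Sum.elim Sum.inl out)
  | one dst next => one dst (keep next)
  | op f dst a b next => op f dst a b (keep next)
  | ifZero a yes no => ifZero a (keep yes) (keep no)

theorem cost_reroute (out : o → ι ⊕ ℕ) (q : ArithProgram o o') : (reroute out q).cost = q.cost := by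
  induction q with
  | ret out' => rfl
  | one dst next ih => simp [reroute, cost, ih]
  | op f dst a b next ih => simp [reroute, cost, ih]
  | ifZero a yes no ih1 ih2 => simp [reroute, cost, ih1, ih2]

theorem cost_seq (q : ArithProgram o o') (p : ArithProgram ι o) :
    (seq q p).cost = p.cost + q.cost := by
  induction p with
  | ret out => simp [seq, cost, cost_reroute]
  | one dst next ih => simp [seq, cost, ih]; omega
  | op f dst a b next ih => simp [seq, cost, ih]; omega
  | ifZero a yes no ih1 ih2 => simp [seq, cost, ih1, ih2]; omega

theorem cost_keep (p : ArithProgram ι o) : (keep p).cost = p.cost := by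
  induction p with
  | ret out => rfl
  | one dst next ih => simp [keep, cost, ih]
  | op f dst a b next ih => simp [keep, cost, ih]
  | ifZero a yes no ih1 ih2 => simp [keep, cost, ih1, ih2]

section Exec

variable {K : Type*} (input : ι → K)

theorem elim_evenAddr (mem : ℕ → K) (a : ι ⊕ ℕ) :
    Sum.elim input mem (evenAddr a) = Sum.elim input (fun j => mem (2 * j)) a := by
  cases a <;> rfl

theorem elim_oddAddr (mem : ℕ → K) (out : o → ι ⊕ ℕ) (a : o ⊕ ℕ) :
    Sum.elim input mem (oddAddr out a) =
      Sum.elim (fun z => Sum.elim input (fun j => mem (2 * j)) (out z))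
        (fun j => mem (2 * j + 1)) a := by
  cases a
  · simp [oddAddr, elim_evenAddr]
  · rfl

theorem update_odd_even (mem : ℕ → K) (i : ℕ) (a : K) :
    (fun j => Function.update mem (2 * i + 1) a (2 * j)) = fun j => mem (2 * j) := by
  funext j
  exact Function.update_of_ne (by omega) _ _

theorem update_odd_odd (mem : ℕ → K) (i : ℕ) (a : K) :
    (fun j => Function.update mem (2 * i + 1) a (2 * j + 1)) =
      Function.update (fun j => mem (2 * j + 1)) i a := by
  funext j
  by_cases h : j = i
  · subst h; simp
  · rw [Function.update_of_ne (by omega), Function.update_of_ne h]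

theorem update_even_odd (mem : ℕ → K) (i : ℕ) (a : K) :
    (fun j => Function.update mem (2 * i) a (2 * j + 1)) = fun j => mem (2 * j + 1) := by
  funext j
  exact Function.update_of_ne (by omega) _ _

theorem update_even_even (mem : ℕ → K) (i : ℕ) (a : K) :
    (fun j => Function.update mem (2 * i) a (2 * j)) =
      Function.update (fun j => mem (2 * j)) i a := by
  funext j
  by_cases h : j = i
  · subst h; simp
  · rw [Function.update_of_ne (by omega), Function.update_of_ne h]

variable [Field K]

theorem exec_reroute (out : o → ι ⊕ ℕ) (q : ArithProgram o o') (mem : ℕ → K) :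
    exec input (reroute out q) mem =
      exec (fun z => Sum.elim input (fun j => mem (2 * j)) (out z)) q
        (fun j => mem (2 * j + 1)) := by
  induction q generalizing mem with
  | ret out' => funext z; simp only [reroute, exec, elim_oddAddr]
  | one dst next ih => simp only [reroute, exec, ih, update_odd_even, update_odd_odd]
  | op f dst a b next ih =>
    simp only [reroute, exec, ih, update_odd_even, update_odd_odd, elim_oddAddr]
  | ifZero a yes no ih1 ih2 =>
    simp only [reroute, exec, ih1, ih2]
    rw [← elim_oddAddr input mem out a]

/-- The two programs share the memory by parity of the cells: the first one writes only even cells,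
so that the second one finds the odd cells as they were, and still has access to the inputs and
results of the first one. -/
theorem exec_seq (q : ArithProgram o o') (p : ArithProgram ι o) (mem : ℕ → K) :
    exec input (seq q p) mem =
      exec (exec input p fun j => mem (2 * j)) q (fun j => mem (2 * j + 1)) := by
  induction p generalizing mem with
  | ret out => simp only [seq, exec_reroute, exec]
  | one dst next ih => simp only [seq, exec, ih, update_even_even, update_even_odd]
  | op f dst a b next ih =>
    simp only [seq, exec, ih, update_even_even, update_even_odd, elim_evenAddr]
  | ifZero a yes no ih1 ih2 =>
    simp only [seq, exec, ih1, ih2]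
    rw [← elim_evenAddr input mem a]
    split_ifs <;> rfl

theorem run_seq (q : ArithProgram o o') (p : ArithProgram ι o) :
    run (seq q p) input = run q (run p input) := exec_seq input q p _

theorem exec_keep (p : ArithProgram ι o) (mem : ℕ → K) :
    exec input (keep p) mem = Sum.elim input (exec input p mem) := by
  induction p generalizing mem with
  | ret out => funext z; cases z <;> rfl
  | one dst next ih => simp only [keep, exec, ih]
  | op f dst a b next ih => simp only [keep, exec, ih]
  | ifZero a yes no ih1 ih2 =>
    simp only [keep, exec, ih1, ih2]
    split_ifs <;> rfl

theorem run_keep (p : ArithProgram ι o) :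
    run (keep p) input = Sum.elim input (run p input) := exec_keep input p _

end Exec

end ArithProgram

-- Cost calculus for functions given uniformly in the field

universe u

/-- Functions between coordinate spaces, given for all fields at once. -/
abbrev UniformMap (ι o : Type) : Type (u + 1) := ∀ (K : Type u) [Field K], (ι → K) → o → K

/-- A uniform map that some program computes with at most `B` operations. -/
def Computes {ι o : Type} (B : ℕ) (f : UniformMap.{u} ι o) : Prop :=
  ∃ p : ArithProgram ι o, p.cost ≤ B ∧ ∀ (K : Type u) [Field K] (x : ι → K), p.run x = f K x

/-- A scalar function that some program computes with at most `B` operations. -/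
def ComputesScalar {ι : Type} (B : ℕ) (f : ∀ (K : Type u) [Field K], (ι → K) → K) : Prop :=
  Computes.{u} B (o := Unit) fun K _ x _ => f K x

namespace Computes

variable {ι o o' : Type} {B B' : ℕ}

theorem mono {f : UniformMap.{u} ι o} (h : Computes B f) (hB : B ≤ B') : Computes B' f := by
  obtain ⟨p, h1, h2⟩ := h
  exact ⟨p, h1.trans hB, h2⟩

theorem congr {f g : UniformMap.{u} ι o} (h : Computes B f)
    (hfg : ∀ (K : Type u) [Field K] (x : ι → K) (z : o), f K x z = g K x z) : Computes B g := by
  obtain ⟨p, h1, h2⟩ := h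
  exact ⟨p, h1, fun K _ x => (h2 K x).trans (funext (hfg K x))⟩

/-- Selecting input cells and zeros is free. -/
theorem select (a : o → Option ι) :
    Computes.{u} 0 fun K _ (x : ι → K) z => (a z).elim 0 x := by
  refine ⟨.ret fun z => (a z).elim (Sum.inr 0) Sum.inl, le_rfl, fun K _ x => funext fun z => ?_⟩
  cases h : a z <;> simp [ArithProgram.run, ArithProgram.exec, h]

theorem proj (a : o → ι) : Computes.{u} 0 fun K _ (x : ι → K) z => x (a z) :=
  select fun z => some (a z)

theorem comp {f : UniformMap.{u} ι o} {g : UniformMap.{u} o o'} (hg : Computes B' g)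
    (hf : Computes B f) : Computes (B + B') fun K _ x => g K (f K x) := by
  obtain ⟨p, h1, h2⟩ := hf
  obtain ⟨q, h3, h4⟩ := hg
  refine ⟨.seq q p, ?_, fun K _ x => ?_⟩
  · rw [ArithProgram.cost_seq]; omega
  · rw [ArithProgram.run_seq, h2, h4]

/-- Composition alone forgets the original input; this form lets a later stage reread it at no cost.
-/
theorem keep {f : UniformMap.{u} ι o} (hf : Computes B f) :
    Computes B (o := ι ⊕ o) fun K _ x => Sum.elim x (f K x) := by
  obtain ⟨p, h1, h2⟩ := hf
  refine ⟨p.keep, by rwa [ArithProgram.cost_keep], fun K _ x => ?_⟩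
  rw [ArithProgram.run_keep, h2]

theorem prod {f : UniformMap.{u} ι o} {g : UniformMap.{u} ι o'} (hf : Computes B f)
    (hg : Computes B' g) :
    Computes (B + B') (o := o ⊕ o') fun K _ x => Sum.elim (f K x) (g K x) := by
  have h1 := (hg.comp (proj.{u} (ι := ι ⊕ o) Sum.inl)).keep.comp hf.keep
  have h2 := (proj.{u} (ι := (ι ⊕ o) ⊕ o') (o := o ⊕ o')
    (Sum.elim (fun z => Sum.inl (Sum.inr z)) Sum.inr)).comp h1
  refine (h2.congr ?_).mono (by omega)
  intro K _ x z
  cases z <;> rfl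

theorem ite_zero {f g : UniformMap.{u} ι o} (a : ι) (hf : Computes B f) (hg : Computes B' g) :
    Computes (max B B' + 1) fun K _ x => open Classical in if x a = 0 then f K x else g K x := by
  obtain ⟨p, h1, h2⟩ := hf
  obtain ⟨q, h3, h4⟩ := hg
  refine ⟨.ifZero (Sum.inl a) p q, ?_, fun K _ x => ?_⟩
  · simp only [ArithProgram.cost]; omega
  · simp only [← h2, ← h4]; rfl

theorem of_eq_zero {f : UniformMap.{u} ι o}
    (h : ∀ (K : Type u) [Field K] (x : ι → K) (z : o), f K x z = 0) : Computes 0 f :=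
  (select.{u} fun _ => none).congr fun K _ x z => (h K x z).symm

end Computes

namespace ComputesScalar

variable {ι : Type} {B B' : ℕ} {f g : ∀ (K : Type u) [Field K], (ι → K) → K}

theorem mono (h : ComputesScalar B f) (hB : B ≤ B') : ComputesScalar B' f := Computes.mono h hB

theorem cell (a : ι) : ComputesScalar.{u} 0 fun K _ (x : ι → K) => x a :=
  Computes.proj fun _ => a

theorem zero : ComputesScalar.{u} 0 fun K _ (_ : ι → K) => (0 : K) :=
  Computes.of_eq_zero fun _ _ _ _ => rfl

theorem one : ComputesScalar.{u} 1 fun K _ (_ : ι → K) => (1 : K) :=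
  ⟨.one 0 (.ret fun _ => Sum.inr 0), le_rfl, fun K _ x => funext fun _ => by
    simp [ArithProgram.run, ArithProgram.exec]⟩

theorem op (s : ArithOp) (hf : ComputesScalar B f) (hg : ComputesScalar B' g) :
    ComputesScalar (B + B' + 1) fun K _ x => s.apply (f K x) (g K x) := by
  have h : Computes.{u} (ι := Unit ⊕ Unit) (o := Unit) 1
      fun K _ x _ => s.apply (x (Sum.inl ())) (x (Sum.inr ())) :=
    ⟨.op s 0 (Sum.inl (Sum.inl ())) (Sum.inl (Sum.inr ())) (.ret fun _ => Sum.inr 0), le_rfl,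
      fun K _ x => funext fun _ => by simp [ArithProgram.run, ArithProgram.exec]⟩
  exact h.comp (Computes.prod hf hg)

theorem add (hf : ComputesScalar B f) (hg : ComputesScalar B' g) :
    ComputesScalar (B + B' + 1) fun K _ x => f K x + g K x := op .add hf hg

theorem sub (hf : ComputesScalar B f) (hg : ComputesScalar B' g) :
    ComputesScalar (B + B' + 1) fun K _ x => f K x - g K x := op .sub hf hg

theorem mul (hf : ComputesScalar B f) (hg : ComputesScalar B' g) :
    ComputesScalar (B + B' + 1) fun K _ x => f K x * g K x := op .mul hf hg

theorem div (hf : ComputesScalar B f) (hg : ComputesScalar B' g) :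
    ComputesScalar (B + B' + 1) fun K _ x => f K x / g K x := op .div hf hg

theorem neg (hf : ComputesScalar B f) : ComputesScalar (B + 1) fun K _ x => - f K x := by
  have h := sub (zero.{u} (ι := ι)) hf
  simp only [zero_sub, zero_add] at h
  exact h

/-- A sum of products of cells. -/
theorem sum_mul {α : Type*} (s : Finset α) (a b : α → ι) :
    ComputesScalar.{u} (2 * s.card) fun K _ (x : ι → K) => ∑ i ∈ s, x (a i) * x (b i) := by
  classical
  induction s using Finset.induction_on with
  | empty => simpa using zero.{u} (ι := ι)
  | insert i s hi ih =>
    rw [Finset.card_insert_of_notMem hi]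
    simp only [Finset.sum_insert hi]
    exact (((cell.{u} (a i)).mul (cell (b i))).add ih).mono (by omega)

end ComputesScalar

namespace Computes

variable {ι o o' : Type} {B B' : ℕ}

/-- A uniform map is computed coordinate by coordinate, where all but finitely many coordinates are
inputs or zero. -/
theorem of_coords {f : UniformMap.{u} ι o} (s : Finset o) (c : o → ℕ) (a : o → Option ι)
    (h1 : ∀ z ∈ s, ComputesScalar (c z) fun K _ x => f K x z)
    (h2 : ∀ z ∉ s, ∀ (K : Type u) [Field K] (x : ι → K), f K x z = (a z).elim 0 x) :
    Computes (∑ z ∈ s, c z) f := by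
  classical
  induction s using Finset.induction_on generalizing f with
  | empty => exact (select a).congr fun K _ x z => (h2 z (by simp) K x).symm
  | insert i s hi ih =>
    rw [Finset.sum_insert hi]
    -- Coordinate `i` is temporarily replaced by its free default, so that the induction hypothesis
    -- for `s` applies; its true value, computed from the same input, is put back in `h4`.
    have h3 : Computes (∑ z ∈ s, c z)
        (fun K _ x z => if z = i then (a i).elim 0 x else f K x z : UniformMap.{u} ι o) := by
      refine ih (fun z hz => ?_) fun z hz K _ x => ?_
      · have : z ≠ i := fun h => hi (h ▸ hz)
        simp only [this, if_false]
        exact h1 z (Finset.mem_insert_of_mem hz)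
      · by_cases hzi : z = i
        · simp [hzi]
        · simp only [hzi, if_false]
          exact h2 z (by simp [hzi, hz]) K x
    have h4 := (proj.{u} (ι := Unit ⊕ o) (o := o)
      fun z => if z = i then Sum.inl () else Sum.inr z).comp
        (prod (h1 i (Finset.mem_insert_self i s)) h3)
    refine (h4.congr ?_).mono (by omega)
    intro K _ x z
    by_cases hzi : z = i <;> simp [hzi]

theorem of_coords_le {f : UniformMap.{u} ι o} (s : Finset o) (c : ℕ) (a : o → Option ι)
    (h1 : ∀ z ∈ s, ComputesScalar c fun K _ x => f K x z)
    (h2 : ∀ z ∉ s, ∀ (K : Type u) [Field K] (x : ι → K), f K x z = (a z).elim 0 x) :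
    Computes (s.card * c) f := by
  simpa using of_coords s (fun _ => c) a h1 h2

/-- A loop over a state, with read-only inputs. -/
theorem loop {f : ℕ → UniformMap.{u} ι o} {g : ℕ → UniformMap.{u} (ι ⊕ o) o} {c : ℕ → ℕ}
    (h0 : Computes B (f 0)) (hg : ∀ j, Computes (c j) (g j))
    (hf : ∀ j (K : Type u) [Field K] (x : ι → K), f (j + 1) K x = g j K (Sum.elim x (f j K x)))
    (T : ℕ) : Computes (B + ∑ j ∈ Finset.range T, c j) (f T) := by
  induction T with
  | zero => simpa using h0
  | succ T ih =>
    rw [Finset.sum_range_succ, ← add_assoc]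
    exact ((hg T).comp ih.keep).congr fun K _ x z => by rw [hf]

end Computes

/-! ### Hankel systems -/

section Hankel

variable {K : Type*} [Field K]

/-- The `N × N` Hankel matrix of the sequence `w` is nonsingular. -/
def HankelNonsingular (w : ℕ → K) (N : ℕ) : Prop :=
  ∀ p : ℕ → K, (∀ l < N, ∑ k ∈ Finset.range N, w (l + k) * p k = 0) → ∀ k < N, p k = 0

/-- The coefficient of index `m` of the product of two power series. -/
def convCoeff (a s : ℕ → K) (m : ℕ) : K := ∑ i ∈ Finset.range (m + 1), a i * s (m - i)

/-- Multiplication of a power series by the variable. -/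
def shiftSeq (a : ℕ → K) : ℕ → K
  | 0 => 0
  | j + 1 => a j

theorem convCoeff_shiftSeq (a s : ℕ → K) (m : ℕ) :
    convCoeff (shiftSeq a) s (m + 1) = convCoeff a s m := by
  unfold convCoeff
  rw [Finset.sum_range_succ']
  simp [shiftSeq]

theorem convCoeff_comb (a b s : ℕ → K) (α β : K) (m : ℕ) :
    convCoeff (fun j => α * a j - β * b j) s m = α * convCoeff a s m - β * convCoeff b s m := by
  unfold convCoeff
  rw [Finset.mul_sum, Finset.mul_sum, ← Finset.sum_sub_distrib]
  exact Finset.sum_congr rfl fun i _ => by ring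

/-- The coefficients of a product with a polynomial of degree at most `d`, in Hankel form. -/
theorem convCoeff_add_eq (a s : ℕ → K) (d l : ℕ) (ha : ∀ j, d < j → a j = 0) :
    convCoeff a s (d + l) = ∑ k ∈ Finset.range (d + 1), s (l + k) * a (d - k) := by
  unfold convCoeff
  rw [← Finset.sum_range_reflect (fun k => s (l + k) * a (d - k))]
  have h : Finset.range (d + 1) ⊆ Finset.range (d + l + 1) :=
    Finset.range_subset_range.2 (by omega)
  rw [← Finset.sum_subset h]
  · refine Finset.sum_congr rfl fun i hi => ?_
    have hi' := Finset.mem_range.1 hi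
    rw [mul_comm, show l + (d + 1 - 1 - i) = d + l - i by omega,
      show d - (d + 1 - 1 - i) = i by omega]
  · intro i _ hi
    rw [ha i (by simpa using hi), zero_mul]

/-- A relation of small degree, valid for `N` consecutive terms, vanishes. -/
theorem HankelNonsingular.eq_zero {w : ℕ → K} {N : ℕ} (hw : HankelNonsingular w N) {a : ℕ → K}
    {d : ℕ} (hd : d < N) (ha : ∀ j, d < j → a j = 0)
    (h : ∀ l < N, convCoeff a w (d + l) = 0) : ∀ j, a j = 0 := by
  -- The reversed coefficients of `a`, padded with zeros up to `N`, form a kernel vector of the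
  -- Hankel matrix.
  have h1 := hw (fun k => if k ≤ d then a (d - k) else 0) fun l hl => by
    refine Eq.trans ?_ ((convCoeff_add_eq a w d l ha).symm.trans (h l hl))
    have hs : Finset.range (d + 1) ⊆ Finset.range N := Finset.range_subset_range.2 hd
    rw [← Finset.sum_subset hs]
    · refine Finset.sum_congr rfl fun i hi => ?_
      rw [if_pos (by have := Finset.mem_range.1 hi; omega)]
    · intro i _ hi
      rw [if_neg (by simp at hi; omega), mul_zero]
  intro j
  by_cases hj : j ≤ d
  · have := h1 (d - j) (by omega)
    rwa [if_pos (by omega), show d - (d - j) = j by omega] at this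
  · exact ha j (by omega)

/-- The columns, from the last one to the first one, of the inverse of a Hankel matrix of size `N`,
from its last column `U` and from a recurrence relation `P` of degree `N`. -/
def hankelInvCol (N : ℕ) (P U : ℕ → K) : ℕ → ℕ → K
  | 0, i => U i
  | q + 1, i => shiftSeq (hankelInvCol N P U q) i - P i * U (N - 1 - q) + U i * P (N - 1 - q)

/-- Shifting a column moves its image under the Hankel matrix H by one row, up to two defects: the
entry pushed out of range, which contributes a multiple of (w_(l+N)) = -HP, and a wrong value in the
last row, which is a multiple of HU. The terms in `P` and `U` in `hankelInvCol` cancel them, and the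
symmetry of H identifies the two multipliers. -/
theorem sum_hankelInvCol {w P U : ℕ → K} {N : ℕ}
    (hP : ∀ l < N, w (l + N) + ∑ k ∈ Finset.range N, w (l + k) * P k = 0)
    (hU : ∀ l < N, ∑ k ∈ Finset.range N, w (l + k) * U k = if l = N - 1 then 1 else 0)
    (q : ℕ) (hq : q < N) :
    ∀ l < N, ∑ i ∈ Finset.range N, w (l + i) * hankelInvCol N P U q i
      = if l = N - 1 - q then 1 else 0 := by
  induction q with
  | zero => simpa [hankelInvCol] using hU
  | succ q ih =>
    replace ih := ih (by omega)
    set Y := hankelInvCol N P U q with hY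
    obtain ⟨M, rfl⟩ : ∃ M, N = M + 1 := ⟨N - 1, by omega⟩
    simp only [Nat.add_sub_cancel] at *
    -- Symmetry of the Hankel matrix as a bilinear form.
    have hswap : ∀ a b : ℕ → K, ∑ l ∈ Finset.range (M + 1), a l *
        ∑ i ∈ Finset.range (M + 1), w (l + i) * b i = ∑ i ∈ Finset.range (M + 1), b i *
          ∑ l ∈ Finset.range (M + 1), w (i + l) * a l := by
      intro a b
      simp only [Finset.mul_sum]
      rw [Finset.sum_comm]
      refine Finset.sum_congr rfl fun i _ => Finset.sum_congr rfl fun l _ => ?_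
      rw [add_comm l i]; ring
    have hpick : ∀ (a : ℕ → K) (j : ℕ), j < M + 1 →
        ∑ l ∈ Finset.range (M + 1), a l * (if l = j then 1 else 0) = a j := by
      intro a j hj
      simp [hj]
    -- The entry lost by the shift: pair `Y` with `U`, whose images are unit vectors.
    have hlast : Y M = U (M - q) := by
      have h1 := hswap U Y
      rw [Finset.sum_congr rfl fun l hl => by rw [ih l (Finset.mem_range.1 hl)],
        hpick _ _ (by omega)] at h1
      rw [h1, Finset.sum_congr rfl fun l hl => by rw [hU l (Finset.mem_range.1 hl)],
        hpick _ _ (by omega)]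
    -- The defect in the last row, where the unshifted matrix has no row `M + 1`: pair `Y` with `P`
    -- and use the recurrence.
    have hnext : ∑ i ∈ Finset.range (M + 1), w (M + 1 + i) * Y i = - P (M - q) := by
      have h1 := hswap P Y
      rw [Finset.sum_congr rfl fun l hl => by rw [ih l (Finset.mem_range.1 hl)],
        hpick _ _ (by omega)] at h1
      rw [h1, ← Finset.sum_neg_distrib]
      refine Finset.sum_congr rfl fun i hi => ?_
      have := hP i (Finset.mem_range.1 hi)
      rw [add_comm (M + 1) i, eq_neg_of_add_eq_zero_left this]; ring
    intro l hl
    have e1 : ∑ i ∈ Finset.range (M + 1), w (l + i) * hankelInvCol (M + 1) P U (q + 1) i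
        = ∑ i ∈ Finset.range (M + 1), w (l + i) * shiftSeq Y i
          - U (M - q) * ∑ i ∈ Finset.range (M + 1), w (l + i) * P i
          + P (M - q) * ∑ i ∈ Finset.range (M + 1), w (l + i) * U i := by
      rw [Finset.mul_sum, Finset.mul_sum, ← Finset.sum_sub_distrib, ← Finset.sum_add_distrib]
      refine Finset.sum_congr rfl fun i _ => ?_
      simp only [hankelInvCol, Nat.add_sub_cancel, ← hY]
      ring
    have e2 : ∑ i ∈ Finset.range (M + 1), w (l + i) * shiftSeq Y i
        = ∑ i ∈ Finset.range (M + 1), w (l + 1 + i) * Y i - w (l + (M + 1)) * U (M - q) := by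
      rw [Finset.sum_range_succ', Finset.sum_range_succ (fun i => w (l + 1 + i) * Y i), hlast]
      simp only [shiftSeq, mul_zero, add_zero]
      rw [show l + 1 + M = l + (M + 1) by ring, add_sub_cancel_right]
      refine Finset.sum_congr rfl fun i _ => ?_
      rw [show l + (i + 1) = l + 1 + i by ring]
    rw [e1, e2, hU l hl, eq_neg_of_add_eq_zero_left (hP l hl)]
    by_cases hlM : l = M
    · subst hlM
      rw [hnext, if_pos rfl, if_neg (by omega)]; ring
    · rw [ih (l + 1) (by omega), if_neg hlM]
      by_cases h2 : l = M - (q + 1)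
      · rw [if_pos h2, if_pos (by omega)]; ring
      · rw [if_neg h2, if_neg (by omega)]; ring

/-- The difference of the two sides lies in the kernel of the Hankel matrix, since the vectors
`hankelInvCol` are the columns of the inverse. -/
theorem HankelNonsingular.eq_of_solution {w P U v γ : ℕ → K} {N : ℕ}
    (hw : HankelNonsingular w N)
    (hP : ∀ l < N, w (l + N) + ∑ k ∈ Finset.range N, w (l + k) * P k = 0)
    (hU : ∀ l < N, ∑ k ∈ Finset.range N, w (l + k) * U k = if l = N - 1 then 1 else 0)
    (hγ : ∀ l < N, v l + ∑ k ∈ Finset.range N, w (l + k) * γ k = 0) (i : ℕ) (hi : i < N) :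
    γ i = - ∑ q ∈ Finset.range N, hankelInvCol N P U q i * v (N - 1 - q) := by
  have h := hw (fun i => γ i + ∑ q ∈ Finset.range N, hankelInvCol N P U q i * v (N - 1 - q))
    (fun l hl => by
      simp only [mul_add, Finset.sum_add_distrib]
      rw [eq_neg_of_add_eq_zero_right (hγ l hl)]
      simp only [Finset.mul_sum]
      rw [Finset.sum_comm]
      -- Column `q` has image the unit vector at `N - 1 - q`, so that row `l` sees only `q = N - 1 -
      -- l`.
      rw [Finset.sum_congr (g := fun q => if q = N - 1 - l then v (N - 1 - q) else 0) rfl]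
      · rw [Finset.sum_ite_eq', if_pos (Finset.mem_range.2 (by omega)),
          show N - 1 - (N - 1 - l) = l by omega]
        ring
      · intro q hq
        have hq' := Finset.mem_range.1 hq
        have := sum_hankelInvCol hP hU q hq' l hl
        simp only [← mul_assoc]
        rw [← Finset.sum_mul, this]
        by_cases hql : q = N - 1 - l
        · rw [if_pos hql, if_pos (by omega), one_mul]
        · rw [if_neg hql, if_neg (by omega), zero_mul]) i hi
  exact eq_neg_of_add_eq_zero_left h

/-! ### A division-free Berlekamp–Massey algorithm -/

/-- The cells of the Berlekamp–Massey algorithm: the sequence, the coefficients of the current and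
of the previous connection polynomial (the latter multiplied by a power of the variable), the
discrepancy of the previous and of the current connection polynomial. -/
inductive BMCell : Type
  | inp (j : ℕ)
  | cur (j : ℕ)
  | old (j : ℕ)
  | piv
  | disc

namespace BMCell

/-- Compute the discrepancy. -/
def setDisc (m : ℕ) (x : BMCell → K) : BMCell → K
  | disc => ∑ i ∈ Finset.range (m + 1), x (cur i) * x (inp (m - i))
  | inp j => x (inp j)
  | cur j => x (cur j)
  | old j => x (old j)
  | piv => x piv

/-- The update for a zero discrepancy. -/
def skip (x : BMCell → K) : BMCell → K
  | disc => x disc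
  | inp j => x (inp j)
  | cur j => x (cur j)
  | old j => shiftSeq (fun i => x (old i)) j
  | piv => x piv

/-- The update of the connection polynomial, when its length does not change. -/
def stay (M : ℕ) (x : BMCell → K) : BMCell → K
  | disc => x disc
  | inp j => x (inp j)
  | cur j => if j < M then x piv * x (cur j) - x disc * x (old j) else 0
  | old j => shiftSeq (fun i => x (old i)) j
  | piv => x piv

/-- The update of the connection polynomial, when its length changes. -/
def jump (M : ℕ) (x : BMCell → K) : BMCell → K
  | disc => x disc
  | inp j => x (inp j)
  | cur j => if j < M then x piv * x (cur j) - x disc * x (old j) else 0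
  | old j => shiftSeq (fun i => x (cur i)) j
  | piv => x disc

/-- `k` steps of the algorithm, from step `m` and length `L` on. -/
def iterate (M : ℕ) : ℕ → ℕ → ℕ → (BMCell → K) → BMCell → K
  | 0, _, _, x => x
  | k + 1, m, L, x => open Classical in
    if setDisc m x disc = 0 then iterate M k (m + 1) L (skip (setDisc m x))
    else if 2 * L ≤ m then iterate M k (m + 1) (m + 1 - L) (jump M (setDisc m x))
    else iterate M k (m + 1) L (stay M (setDisc m x))

/-- The initial state. -/
def start (w : ℕ → K) : BMCell → K
  | disc => 0
  | inp j => w j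
  | cur j => if j = 0 then 1 else 0
  | old _ => 0
  | piv => 1

/-- The invariant at step `m`, for the length `L`. -/
structure Inv (w : ℕ → K) (m L : ℕ) (x : BMCell → K) : Prop where
  le : L ≤ m
  inp_eq : ∀ j, x (inp j) = w j
  cur_deg : ∀ j, L < j → x (cur j) = 0
  cur_rel : ∀ j, L ≤ j → j < m → convCoeff (fun i => x (cur i)) w j = 0
  cur_zero : x (cur 0) ≠ 0
  old_deg : ∀ j, m + 1 - L < j → x (old j) = 0
  old_rel : ∀ j, m + 1 - L ≤ j → j < m → convCoeff (fun i => x (old i)) w j = 0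
  old_piv : 1 ≤ L → convCoeff (fun i => x (old i)) w m = x piv
  old_init : L = 0 → ∀ j, x (old j) = 0
  old_zero : x (old 0) = 0
  piv_ne : x piv ≠ 0

/-- The previous polynomial starts as zero, with a dummy pivot: as long as the length is 0 the
invariant does not tie the pivot to a discrepancy, and only its being nonzero matters. -/
theorem inv_start (w : ℕ → K) : Inv w 0 0 (start w) where
  le := le_rfl
  inp_eq _ := rfl
  cur_deg j hj := by simp [start, hj.ne']
  cur_rel j _ hj := by omega
  cur_zero := by simp [start]
  old_deg _ _ := rfl
  old_rel j _ hj := by omega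
  old_piv h := by omega
  old_init _ _ := rfl
  old_zero := rfl
  piv_ne := by simp [start]

variable {w : ℕ → K} {m L M : ℕ} {x : BMCell → K}

theorem Inv.setDisc (h : Inv w m L x) : Inv w m L (setDisc m x) :=
  ⟨h.le, h.inp_eq, h.cur_deg, h.cur_rel, h.cur_zero, h.old_deg, h.old_rel, h.old_piv, h.old_init,
    h.old_zero, h.piv_ne⟩

theorem Inv.disc_eq (h : Inv w m L x) :
    BMCell.setDisc m x disc = convCoeff (fun i => x (cur i)) w m := by
  simp only [BMCell.setDisc, h.inp_eq]; rfl

theorem Inv.shift_deg (h : Inv w m L x) (j : ℕ) (hj : m + 1 + 1 - L < j) :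
    shiftSeq (fun i => x (old i)) j = 0 := by
  cases j with
  | zero => rfl
  | succ j => exact h.old_deg j (by have := h.le; omega)

theorem Inv.shift_rel (h : Inv w m L x) (j : ℕ) (hj : m + 1 + 1 - L ≤ j) (hjm : j < m + 1) :
    convCoeff (shiftSeq fun i => x (old i)) w j = 0 := by
  cases j with
  | zero => have := h.le; omega
  | succ j =>
    rw [convCoeff_shiftSeq]
    exact h.old_rel j (by have := h.le; omega) (by omega)

theorem Inv.shift_init (h : Inv w m L x) (hL : L = 0) (j : ℕ) :
    shiftSeq (fun i => x (old i)) j = 0 := by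
  cases j with
  | zero => rfl
  | succ j => exact h.old_init hL j

/-- Multiplying the previous polynomial by the variable moves its first nonzero discrepancy from `m`
to `m + 1`, where the next step needs it. -/
theorem Inv.skip (h : Inv w m L x) (hd : convCoeff (fun i => x (cur i)) w m = 0) :
    Inv w (m + 1) L (skip x) where
  le := h.le.trans (Nat.le_succ m)
  inp_eq := h.inp_eq
  cur_deg := h.cur_deg
  cur_rel j h1 h2 := by
    rcases Nat.lt_succ_iff_lt_or_eq.1 h2 with h3 | rfl
    · exact h.cur_rel j h1 h3
    · exact hd
  cur_zero := h.cur_zero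
  old_deg := h.shift_deg
  old_rel := h.shift_rel
  old_piv hL := by
    change convCoeff (shiftSeq fun i => x (old i)) w (m + 1) = x piv
    rw [convCoeff_shiftSeq]
    exact h.old_piv hL
  old_init := h.shift_init
  old_zero := rfl
  piv_ne := h.piv_ne

/-- The truncation at `M`, which makes the update finite, loses nothing: both polynomials have
degree at most `m + 1`. -/
theorem Inv.comb_eq (h : Inv w m L x) (hM : m + 1 < M) (j : ℕ) :
    (if j < M then x piv * x (cur j) - x disc * x (old j) else 0)
      = x piv * x (cur j) - x disc * x (old j) := by
  have := h.le
  split_ifs with hj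
  · rfl
  · rw [h.cur_deg j (by omega), h.old_deg j (by omega)]; ring

/-- Cross-multiplication by the pivot and the discrepancy cancels the two values at index `m`
without a division; at smaller indices both terms vanish already. -/
theorem Inv.comb_rel (h : Inv w m L x) (hd : convCoeff (fun i => x (cur i)) w m = x disc)
    (j : ℕ) (h1 : L ≤ j) (h2 : m + 1 - L ≤ j) (h3 : j < m + 1) :
    convCoeff (fun j => x piv * x (cur j) - x disc * x (old j)) w j = 0 := by
  rw [convCoeff_comb]
  rcases Nat.lt_succ_iff_lt_or_eq.1 h3 with h4 | rfl
  · rw [h.cur_rel j h1 h4, h.old_rel j h2 h4]; ring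
  · rw [hd, h.old_piv (by omega)]; ring

theorem Inv.stay (h : Inv w m L x) (hd : convCoeff (fun i => x (cur i)) w m = x disc)
    (hL : ¬ 2 * L ≤ m) (hM : m + 1 < M) : Inv w (m + 1) L (stay M x) where
  le := h.le.trans (Nat.le_succ m)
  inp_eq := h.inp_eq
  cur_deg j hj := by
    change (if j < M then x piv * x (cur j) - x disc * x (old j) else 0) = 0
    rw [h.comb_eq hM, h.cur_deg j hj, h.old_deg j (by omega)]; ring
  cur_rel j h1 h2 := by
    simp only [BMCell.stay, h.comb_eq hM]
    exact h.comb_rel hd j h1 (by omega) h2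
  cur_zero := by
    change (if 0 < M then x piv * x (cur 0) - x disc * x (old 0) else 0) ≠ 0
    rw [h.comb_eq hM, h.old_zero, mul_zero, sub_zero]
    exact mul_ne_zero h.piv_ne h.cur_zero
  old_deg := h.shift_deg
  old_rel := h.shift_rel
  old_piv hL := by
    change convCoeff (shiftSeq fun i => x (old i)) w (m + 1) = x piv
    rw [convCoeff_shiftSeq]
    exact h.old_piv hL
  old_init := h.shift_init
  old_zero := rfl
  piv_ne := h.piv_ne

/-- The current polynomial, multiplied by the variable, becomes the previous one: it failed for the
first time at `m`, with the discrepancy as value, which is therefore the new pivot. -/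
theorem Inv.jump (h : Inv w m L x) (hd : convCoeff (fun i => x (cur i)) w m = x disc)
    (hne : x disc ≠ 0) (hL : 2 * L ≤ m) (hM : m + 1 < M) :
    Inv w (m + 1) (m + 1 - L) (jump M x) where
  le := Nat.sub_le _ _
  inp_eq := h.inp_eq
  cur_deg j hj := by
    change (if j < M then x piv * x (cur j) - x disc * x (old j) else 0) = 0
    rw [h.comb_eq hM, h.cur_deg j (by omega), h.old_deg j (by omega)]; ring
  cur_rel j h1 h2 := by
    simp only [BMCell.jump, h.comb_eq hM]
    exact h.comb_rel hd j (by omega) (by omega) h2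
  cur_zero := by
    change (if 0 < M then x piv * x (cur 0) - x disc * x (old 0) else 0) ≠ 0
    rw [h.comb_eq hM, h.old_zero, mul_zero, sub_zero]
    exact mul_ne_zero h.piv_ne h.cur_zero
  old_deg j hj := by
    cases j with
    | zero => rfl
    | succ j => exact h.cur_deg j (by omega)
  old_rel j h1 h2 := by
    change convCoeff (shiftSeq fun i => x (cur i)) w j = 0
    cases j with
    | zero => omega
    | succ j =>
      rw [convCoeff_shiftSeq]
      exact h.cur_rel j (by omega) (by omega)
  old_piv _ := by
    change convCoeff (shiftSeq fun i => x (cur i)) w (m + 1) = x disc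
    rw [convCoeff_shiftSeq, hd]
  old_init h0 := by omega
  old_zero := rfl
  piv_ne := hne

theorem Inv.iterate {k : ℕ} (h : Inv w m L x) (hM : m + k < M) :
    ∃ L', Inv w (m + k) L' (iterate M k m L x) := by
  induction k generalizing m L x with
  | zero => exact ⟨L, h⟩
  | succ k ih =>
    have hd := h.disc_eq
    rw [show m + (k + 1) = m + 1 + k by ring] at hM ⊢
    unfold BMCell.iterate
    split_ifs with h1 h2
    · exact ih (h.setDisc.skip (hd.symm.trans h1)) hM
    · exact ih (h.setDisc.jump hd.symm h1 h2 (by omega)) hM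
    · exact ih (h.setDisc.stay hd.symm h2 (by omega)) hM

/-- After `2 N` steps for a sequence with nonsingular Hankel matrix, the length is `N`. -/
theorem Inv.length_eq {N : ℕ} (hw : HankelNonsingular w N) (h : Inv w (2 * N) L x) :
    L = N := by
  rcases lt_trichotomy L N with hL | hL | hL
  -- A length below `N` would give a relation of degree less than `N` valid for at least `N`
  -- consecutive terms, so that it would vanish, against its nonzero constant term.
  · exact absurd (hw.eq_zero hL h.cur_deg (fun l hl => h.cur_rel _ (by omega) (by omega)) 0)
      h.cur_zero
  · exact hL
  · exfalso
    have hle := h.le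
    -- For a length above `N`, the previous polynomial divided by the variable has degree at most `2
    -- * N - L < N` and is valid for `L - 1 ≥ N` consecutive terms; it would vanish, against the
    -- nonzero pivot.
    have hs : (fun i => x (old i)) = shiftSeq fun i => x (old (i + 1)) := by
      funext i
      cases i with
      | zero => exact h.old_zero
      | succ i => rfl
    have h0 : ∀ j, x (old (j + 1)) = 0 :=
      hw.eq_zero (d := 2 * N - L) (a := fun j => x (old (j + 1))) (by omega)
        (fun j hj => h.old_deg _ (by omega)) fun l hl => by
          rw [← convCoeff_shiftSeq, ← hs]
          exact h.old_rel _ (by omega) (by omega)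
    have h1 := h.old_piv (by omega)
    rw [hs, funext h0] at h1
    apply h.piv_ne
    rw [← h1]
    refine Finset.sum_eq_zero fun i _ => ?_
    cases i <;> simp [shiftSeq]

/-- The monic recurrence relation of degree `N` found by the algorithm. -/
def rel (N : ℕ) (x : BMCell → K) (k : ℕ) : K := x (cur (N - k)) / x (cur 0)

/-- The last column of the inverse of the Hankel matrix found by the algorithm. -/
def lastCol (N : ℕ) (x : BMCell → K) (k : ℕ) : K :=
  (x (old (N + 1 - k)) - x (old 1) * rel N x k) / x piv

theorem Inv.rel_spec {N : ℕ} (h : Inv w (2 * N) N x) :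
    ∀ l < N, w (l + N) + ∑ k ∈ Finset.range N, w (l + k) * rel N x k = 0 := by
  intro l hl
  have h1 := h.cur_rel (N + l) (by omega) (by omega)
  rw [convCoeff_add_eq _ _ _ _ h.cur_deg, Finset.sum_range_succ, Nat.sub_self] at h1
  have h0 := h.cur_zero
  have h2 : ∑ k ∈ Finset.range N, w (l + k) * rel N x k
      = (∑ k ∈ Finset.range N, w (l + k) * x (cur (N - k))) / x (cur 0) := by
    rw [Finset.sum_div]
    exact Finset.sum_congr rfl fun k _ => by rw [rel]; ring
  rw [h2]
  field_simp
  linear_combination h1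

/-- The previous polynomial has zero constant term and degree at most `N + 1`; its products with the
sequence vanish at the indices `N + 1, ..., 2N - 1` and equal the pivot at `2N`. In Hankel form this
is the last unit vector up to the pivot, with one unknown too many; that one, `old 1`, is removed
with the monic recurrence. -/
theorem Inv.lastCol_spec {N : ℕ} (hN : 0 < N) (h : Inv w (2 * N) N x) :
    ∀ l < N, ∑ k ∈ Finset.range N, w (l + k) * lastCol N x k = if l = N - 1 then 1 else 0 := by
  intro l hl
  have hb := h.piv_ne
  have h1 : convCoeff (fun i => x (old i)) w (N + 1 + l) = if l = N - 1 then x piv else 0 := by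
    split_ifs with hlN
    · rw [← h.old_piv hN]; congr 1; omega
    · exact h.old_rel _ (by omega) (by omega)
  rw [convCoeff_add_eq _ _ _ _ (fun j hj => h.old_deg j (by omega)), Finset.sum_range_succ,
    Finset.sum_range_succ, Nat.sub_self, h.old_zero, show N + 1 - N = 1 by omega] at h1
  have h3 : ∑ k ∈ Finset.range N, w (l + k) * lastCol N x k
      = (∑ k ∈ Finset.range N, w (l + k) * x (old (N + 1 - k))
        - x (old 1) * ∑ k ∈ Finset.range N, w (l + k) * rel N x k) / x piv := by
    rw [Finset.mul_sum, ← Finset.sum_sub_distrib, Finset.sum_div]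
    exact Finset.sum_congr rfl fun k _ => by rw [lastCol]; ring
  rw [h3, eq_neg_of_add_eq_zero_right (h.rel_spec l hl)]
  rw [div_eq_iff hb]
  have h4 : (if l = N - 1 then (1 : K) else 0) * x piv = if l = N - 1 then x piv else 0 := by
    split_ifs <;> simp
  rw [h4, ← h1]; ring

end BMCell

/-- The solution of the Hankel system `H γ = - v`, as the algorithm computes it. -/
def hankelSolve (N : ℕ) (w v : ℕ → K) (i : ℕ) : K :=
  - ∑ q ∈ Finset.range N,
    hankelInvCol N (BMCell.rel N (BMCell.iterate (2 * N + 1) (2 * N) 0 0 (BMCell.start w)))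
      (BMCell.lastCol N (BMCell.iterate (2 * N + 1) (2 * N) 0 0 (BMCell.start w))) q i
      * v (N - 1 - q)

theorem HankelNonsingular.eq_hankelSolve {w v γ : ℕ → K} {N : ℕ} (hw : HankelNonsingular w N)
    (hγ : ∀ l < N, v l + ∑ k ∈ Finset.range N, w (l + k) * γ k = 0) (i : ℕ) (hi : i < N) :
    γ i = hankelSolve N w v i := by
  -- The first `2 * N` terms of the sequence are exactly those in the Hankel matrix and in the
  -- recurrence of degree `N`; `2 * N + 1` is the least admissible truncation.
  obtain ⟨L, h⟩ := (BMCell.inv_start w).iterate (k := 2 * N) (M := 2 * N + 1) (by omega)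
  rw [zero_add] at h
  obtain rfl := h.length_eq hw
  exact hw.eq_of_solution h.rel_spec (h.lastCol_spec (by omega)) hγ i hi

end Hankel

/-! ### Operation count of the solution of Hankel systems -/

namespace BMCell

theorem computes_setDisc (m : ℕ) :
    Computes.{u} (2 * (m + 1)) fun K _ (x : BMCell → K) => setDisc m x := by
  have h := Computes.of_coords_le.{u} (f := fun K _ (x : BMCell → K) => setDisc m x) {disc}
    (2 * (m + 1)) some
    (fun z hz => by
      rw [Finset.mem_singleton.1 hz]
      simpa [setDisc] using ComputesScalar.sum_mul.{u} (Finset.range (m + 1)) cur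
        fun i => inp (m - i))
    (fun z hz K _ x => by
      cases z <;> first | rfl | simp at hz)
  simpa using h

theorem computes_skip : Computes.{u} 0 fun K _ (x : BMCell → K) => skip x :=
  (Computes.select.{u} fun z : BMCell => match z with
    | old 0 => none
    | old (j + 1) => some (old j)
    | z => some z).congr fun K _ x z => by
      rcases z with j | j | (_ | j) | _ | _ <;> rfl

theorem computes_comb (M j : ℕ) (hj : j < M) : ComputesScalar.{u} 3 fun K _ (x : BMCell → K) =>
    if j < M then x piv * x (cur j) - x disc * x (old j) else 0 := by
  simp only [hj, if_true]
  exact ((ComputesScalar.cell.{u} piv).mul (.cell (cur j))).sub ((.mul (.cell disc) (.cell (old j))))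

theorem computes_stay (M : ℕ) : Computes.{u} (M * 3) fun K _ (x : BMCell → K) => stay M x := by
  classical
  have h := Computes.of_coords_le.{u} (f := fun K _ (x : BMCell → K) => stay M x)
    ((Finset.range M).image cur) 3
    (fun z => match z with
      | old 0 => none
      | old (j + 1) => some (old j)
      | cur _ => none
      | z => some z)
    (fun z hz => by
      obtain ⟨j, hj, rfl⟩ := Finset.mem_image.1 hz
      exact computes_comb M j (Finset.mem_range.1 hj))
    (fun z hz K _ x => by
      rcases z with j | j | (_ | j) | _ | _ <;> try rfl
      have hj : ¬ j < M := fun hj => hz (Finset.mem_image_of_mem _ (Finset.mem_range.2 hj))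
      simp [stay, hj])
  exact h.mono (Nat.mul_le_mul_right _ (Finset.card_image_le.trans (by simp)))

theorem computes_jump (M : ℕ) : Computes.{u} (M * 3) fun K _ (x : BMCell → K) => jump M x := by
  classical
  have h := Computes.of_coords_le.{u} (f := fun K _ (x : BMCell → K) => jump M x)
    ((Finset.range M).image cur) 3
    (fun z => match z with
      | old 0 => none
      | old (j + 1) => some (cur j)
      | cur _ => none
      | piv => some disc
      | z => some z)
    (fun z hz => by
      obtain ⟨j, hj, rfl⟩ := Finset.mem_image.1 hz
      exact computes_comb M j (Finset.mem_range.1 hj))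
    (fun z hz K _ x => by
      rcases z with j | j | (_ | j) | _ | _ <;> try rfl
      have hj : ¬ j < M := fun hj => hz (Finset.mem_image_of_mem _ (Finset.mem_range.2 hj))
      simp [jump, hj])
  exact h.mono (Nat.mul_le_mul_right _ (Finset.card_image_le.trans (by simp)))

/-- A step costs at most `2 * M` for the discrepancy, `3 * M` for the update and one zero test. The
comparison of `2 * L` with `m` is free: the length depends only on the branch of the computation
tree and is not stored in a cell. -/
theorem computes_iterate (M k m L : ℕ) (hM : m + k < M) :
    Computes.{u} (k * (5 * M + 1)) fun K _ (x : BMCell → K) => iterate M k m L x := by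
  induction k generalizing m L with
  | zero => exact (Computes.proj.{u} id).mono (by omega)
  | succ k ih =>
    have h1 := (ih (m + 1) L (by omega)).comp computes_skip.{u}
    have h2 := (ih (m + 1) (m + 1 - L) (by omega)).comp (computes_jump.{u} M)
    have h3 := (ih (m + 1) L (by omega)).comp (computes_stay.{u} M)
    have h4 : Computes.{u} (M * 3 + k * (5 * M + 1)) fun K _ (x : BMCell → K) =>
        if 2 * L ≤ m then iterate M k (m + 1) (m + 1 - L) (jump M x)
        else iterate M k (m + 1) L (stay M x) := by
      by_cases hL : 2 * L ≤ m
      · simpa only [if_pos hL] using h2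
      · simpa only [if_neg hL] using h3
    have h5 := (h1.ite_zero disc h4).comp (computes_setDisc.{u} m)
    refine (h5.congr fun K _ x z => ?_).mono ?_
    · rw [iterate]
    · have h6 := add_one_mul k (5 * M + 1)
      rw [max_eq_right (by omega)]; omega

/-- The connection polynomial in the form of the last column of the inverse matrix and of the
recurrence relation. -/
def result (N : ℕ) {K : Type*} [Field K] (x : BMCell → K) : ℕ ⊕ ℕ → K
  | Sum.inl k => if k < N then rel N x k else 0
  | Sum.inr k => if k < N then lastCol N x k else 0

theorem computes_result (N : ℕ) :
    Computes.{u} (2 * N * 4) fun K _ (x : BMCell → K) => result N x := by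
  classical
  have hrel : ∀ k, ComputesScalar.{u} 1 fun K _ (x : BMCell → K) => rel N x k := fun k =>
    (ComputesScalar.cell.{u} (cur (N - k))).div (.cell (cur 0))
  have h := Computes.of_coords_le.{u} (f := fun K _ (x : BMCell → K) => result N x)
    ((Finset.range N).disjSum (Finset.range N)) 4 (fun _ => none)
    (fun z hz => by
      rcases z with k | k
      · have hk : k < N := by simpa using hz
        simp only [result, hk, if_true]
        exact (hrel k).mono (by omega)
      · have hk : k < N := by simpa using hz
        simp only [result, hk, if_true]
        exact ((ComputesScalar.cell.{u} (old (N + 1 - k))).sub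
          ((ComputesScalar.cell (old 1)).mul (hrel k))).div (.cell piv))
    (fun z hz K _ x => by
      rcases z with k | k
      · have hk : ¬ k < N := by simpa using hz
        simp [result, hk]
      · have hk : ¬ k < N := by simpa using hz
        simp [result, hk])
  exact h.mono (by rw [Finset.card_disjSum, Finset.card_range]; omega)

theorem computes_start : Computes.{u} 2 fun K _ (w : ℕ → K) => start w := by
  classical
  have h := Computes.of_coords_le.{u} (f := fun K _ (w : ℕ → K) => start w) {cur 0, piv} 1
    (fun z => match z with
      | inp j => some j
      | _ => none)
    (fun z hz => by
      rcases Finset.mem_insert.1 hz with rfl | hz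
      · exact ComputesScalar.one
      · rw [Finset.mem_singleton.1 hz]
        exact ComputesScalar.one)
    (fun z hz K _ x => by
      rcases z with j | j | j | _ | _ <;> try rfl
      · have hj : j ≠ 0 := by rintro rfl; simp at hz
        simp [start, hj]
      · simp at hz)
  exact h.mono (by rw [Finset.card_pair (by simp)])

end BMCell

/-- Allows the finitely many coefficients in `BMCell.result`, which are cut off at `N`, to replace
the full sequences. -/
theorem hankelInvCol_congr {K : Type*} [Field K] {N : ℕ} {P U P' U' : ℕ → K}
    (hP : ∀ k < N, P k = P' k) (hU : ∀ k < N, U k = U' k) (q i : ℕ) (hi : i < N) :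
    hankelInvCol N P U q i = hankelInvCol N P' U' q i := by
  induction q generalizing i with
  | zero => exact hU i hi
  | succ q ih =>
    have h : shiftSeq (hankelInvCol N P U q) i = shiftSeq (hankelInvCol N P' U' q) i := by
      cases i with
      | zero => rfl
      | succ i => exact ih i (by omega)
    simp only [hankelInvCol]
    rw [h, hP i hi, hU i hi, hP _ (by omega : N - 1 - q < N), hU _ (by omega : N - 1 - q < N)]

/-- The first columns of the inverse of a Hankel matrix. -/
def hankelInvTable {K : Type*} [Field K] (N T : ℕ) (x : ℕ ⊕ ℕ → K) (z : ℕ × ℕ) : K :=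
  if z.1 ≤ T ∧ z.2 < N then
    hankelInvCol N (fun k => x (Sum.inl k)) (fun k => x (Sum.inr k)) z.1 z.2
  else 0

theorem computes_hankelInvTable (N T : ℕ) :
    Computes.{u} (T * (N * 4)) fun K _ (x : ℕ ⊕ ℕ → K) => hankelInvTable N T x := by
  classical
  have h0 : Computes.{u} 0 fun K _ (x : ℕ ⊕ ℕ → K) => hankelInvTable N 0 x :=
    (Computes.select.{u} fun z : ℕ × ℕ =>
      if z.1 = 0 ∧ z.2 < N then some (Sum.inr z.2) else none).congr fun K _ x z => by
        by_cases h : z.1 = 0 ∧ z.2 < N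
        · simp [hankelInvTable, h, hankelInvCol]
        · simp [hankelInvTable, h]
  let g : ℕ → UniformMap.{u} ((ℕ ⊕ ℕ) ⊕ (ℕ × ℕ)) (ℕ × ℕ) := fun j K _ x z =>
    if z.1 = j + 1 ∧ z.2 < N then
      shiftSeq (fun i => x (Sum.inr (j, i))) z.2
        - x (Sum.inl (Sum.inl z.2)) * x (Sum.inl (Sum.inr (N - 1 - j)))
        + x (Sum.inl (Sum.inr z.2)) * x (Sum.inl (Sum.inl (N - 1 - j)))
    else x (Sum.inr z)
  have hg : ∀ j, Computes (N * 4) (g j) := fun j => by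
    have h := Computes.of_coords_le.{u} (f := g j) ((Finset.range N).image fun i => (j + 1, i)) 4
      (fun z => some (Sum.inr z))
      (fun z hz => by
        obtain ⟨i, hi, rfl⟩ := Finset.mem_image.1 hz
        have hs : ComputesScalar.{u} 0 fun K _ (x : (ℕ ⊕ ℕ) ⊕ (ℕ × ℕ) → K) =>
            shiftSeq (fun i => x (Sum.inr (j, i))) i := by
          cases i with
          | zero => exact ComputesScalar.zero
          | succ i => exact ComputesScalar.cell (Sum.inr (j, i))
        simp only [g, Finset.mem_range.1 hi, and_self, if_true]
        exact (hs.sub ((ComputesScalar.cell _).mul (.cell _))).add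
          ((ComputesScalar.cell _).mul (.cell _)))
      (fun z hz K _ x => by
        have : ¬ (z.1 = j + 1 ∧ z.2 < N) := fun ⟨h1, h2⟩ =>
          hz (Finset.mem_image.2 ⟨z.2, Finset.mem_range.2 h2, by rw [← h1]⟩)
        simp [g, this])
    exact h.mono (Nat.mul_le_mul_right _ (Finset.card_image_le.trans (by simp)))
  have h := Computes.loop (f := fun T K _ (x : ℕ ⊕ ℕ → K) => hankelInvTable N T x) (g := g)
    h0 hg (fun j K _ x => by
      funext ⟨q, i⟩
      by_cases hi : i < N
      · rcases lt_trichotomy q (j + 1) with h | rfl | h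
        · simp [g, hankelInvTable, hi, h.ne, h.le, Nat.lt_succ_iff.1 h]
        · cases i with
          | zero => simp [g, hankelInvTable, hi, hankelInvCol, shiftSeq]
          | succ i =>
            simp [g, hankelInvTable, hi, hankelInvCol, shiftSeq, (Nat.lt_succ_self i).trans hi]
        · simp [g, hankelInvTable, h.ne', show ¬ q ≤ j + 1 by omega, show ¬ q ≤ j by omega]
      · simp [g, hankelInvTable, hi]) T
  simpa using h

/-- The solutions of Hankel systems with the same matrix. -/
def hankelSolveAll {K : Type*} [Field K] {ρ : Type} (N : ℕ) (x : ℕ ⊕ ρ × ℕ → K) (z : ρ × ℕ) : K :=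
  if z.2 < N then hankelSolve N (fun j => x (Sum.inl j)) (fun l => x (Sum.inr (z.1, l))) z.2 else 0

/-- The inverse matrix is computed once, with `24 * N ^ 2 + 20 * N + 2` operations, and shared; each
right-hand side then costs `N` scalar products, `2 * N ^ 2 + N` operations. -/
theorem computes_hankelSolveAll (ρ : Type) [Fintype ρ] [Nonempty ρ] (N : ℕ) (hN : 0 < N) :
    Computes.{u} (60 * Fintype.card ρ * N ^ 2) fun K _ (x : ℕ ⊕ ρ × ℕ → K) =>
      hankelSolveAll N x := by
  classical
  have h1 := (computes_hankelInvTable.{u} N N).comp ((BMCell.computes_result.{u} N).comp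
    ((BMCell.computes_iterate.{u} (2 * N + 1) (2 * N) 0 0 (by omega)).comp
      (BMCell.computes_start.{u}.comp (Computes.proj.{u} (ι := ℕ ⊕ ρ × ℕ) Sum.inl))))
  let g : UniformMap.{u} ((ℕ ⊕ ρ × ℕ) ⊕ (ℕ × ℕ)) (ρ × ℕ) := fun K _ x z =>
    if z.2 < N then - ∑ q ∈ Finset.range N,
      x (Sum.inr (q, z.2)) * x (Sum.inl (Sum.inr (z.1, N - 1 - q))) else 0
  have hg : Computes (Fintype.card ρ * N * (2 * N + 1)) g := by
    have h := Computes.of_coords_le.{u} (f := g) (Finset.univ ×ˢ Finset.range N) (2 * N + 1)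
      (fun _ => none)
      (fun z hz => by
        have hz' : z.2 < N := by simpa using hz
        simp only [g, hz', if_true]
        simpa using (ComputesScalar.sum_mul.{u} (Finset.range N)
          (fun q => (Sum.inr (q, z.2) : (ℕ ⊕ ρ × ℕ) ⊕ (ℕ × ℕ)))
          fun q => Sum.inl (Sum.inr (z.1, N - 1 - q))).neg)
      (fun z hz K _ x => by
        have hz' : ¬ z.2 < N := by simpa using hz
        simp [g, hz'])
    simpa using h
  refine ((hg.comp h1.keep).congr fun K _ x z => ?_).mono ?_
  · simp only [g, hankelSolveAll]
    split_ifs with hz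
    · simp only [hankelSolve, Sum.elim_inr, Sum.elim_inl]
      congr 1
      refine Finset.sum_congr rfl fun q hq => ?_
      congr 1
      rw [hankelInvTable, if_pos ⟨(Finset.mem_range.1 hq).le, hz⟩]
      exact hankelInvCol_congr (fun k hk => by simp [BMCell.result, hk])
        (fun k hk => by simp [BMCell.result, hk]) _ _ hz
    · rfl
  · have hρ : 1 ≤ Fintype.card ρ := Fintype.card_pos
    have h2 : N ^ 2 ≤ Fintype.card ρ * N ^ 2 := Nat.le_mul_of_pos_left _ hρ
    have h3 : Fintype.card ρ * N ≤ Fintype.card ρ * N ^ 2 :=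
      Nat.mul_le_mul_left _ (Nat.le_self_pow (by norm_num) N)
    have h4 : N ≤ N ^ 2 := Nat.le_self_pow (by norm_num) N
    ring_nf
    ring_nf at h2 h3
    nlinarith

/-! ### Gröbner bases and monomial bases of quotients -/

section GroebnerBasis

variable {n : ℕ} {K : Type*} [Field K] {m : MonomialOrder (Fin n)}
  {I : Ideal (MvPolynomial (Fin n) K)} {𝒢 : Set (MvPolynomial (Fin n) K)}

namespace IsReducedGroebnerBasis

theorem eq_zero_of_support (h : IsReducedGroebnerBasis m I 𝒢) {f : MvPolynomial (Fin n) K}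
    (hf : f ∈ I) (hs : ∀ s ∈ f.support, s ∈ staircase m 𝒢) : f = 0 := by
  by_contra h0
  obtain ⟨g, hg, hle⟩ := h.2.1 f hf h0
  exact hs _ (m.degree_mem_support h0) g hg hle

theorem exists_normalForm (h : IsReducedGroebnerBasis m I 𝒢) (f : MvPolynomial (Fin n) K) :
    ∃ r, f - r ∈ I ∧ ∀ s ∈ r.support, s ∈ staircase m 𝒢 := by
  obtain ⟨g, r, h1, -, h3⟩ := m.div_set (B := 𝒢)
    (fun b hb => by rw [(h.1 b hb).2.leadingCoeff_eq_one]; exact isUnit_one) f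
  refine ⟨r, ?_, fun s hs g hg => h3 s hs g hg⟩
  rw [h1, add_sub_cancel_right, Finsupp.linearCombination_apply]
  exact Ideal.sum_mem _ fun b _ => I.mul_mem_left _ (h.1 b b.2).1

/-- A monomial of `g` divisible by the leading one would also be at least as large in the order,
hence equal to it; the other basis elements are excluded by reducedness. -/
theorem mem_staircase_of_ne_degree (h : IsReducedGroebnerBasis m I 𝒢)
    {g : MvPolynomial (Fin n) K} (hg : g ∈ 𝒢) {s : Fin n →₀ ℕ} (hs : s ∈ g.support)
    (hne : s ≠ m.degree g) : s ∈ staircase m 𝒢 := by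
  intro g' hg' hle
  by_cases hgg : g' = g
  · subst hgg
    exact hne (m.toSyn.injective (le_antisymm (m.le_degree hs) (m.toSyn_monotone hle)))
  · exact h.2.2 g' hg' g hg hgg s hs hle

theorem linearIndependent (h : IsReducedGroebnerBasis m I 𝒢) :
    LinearIndependent K fun s : staircase m 𝒢 =>
      Ideal.Quotient.mk I (MvPolynomial.monomial (s : Fin n →₀ ℕ) 1) := by
  classical
  rw [linearIndependent_iff']
  intro t c hc
  have hz : (∑ s ∈ t, MvPolynomial.monomial (s : Fin n →₀ ℕ) (c s)) = 0 := by
    refine h.eq_zero_of_support ?_ fun s hs => ?_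
    · rw [← Ideal.Quotient.eq_zero_iff_mem, map_sum, ← hc]
      refine Finset.sum_congr rfl fun s _ => ?_
      rw [← Ideal.Quotient.mkₐ_eq_mk K, ← map_smul, MvPolynomial.smul_monomial, smul_eq_mul,
        mul_one]
    · rw [MvPolynomial.mem_support_iff, MvPolynomial.coeff_sum] at hs
      obtain ⟨s', _, hs'⟩ := Finset.exists_ne_zero_of_sum_ne_zero hs
      rw [MvPolynomial.coeff_monomial] at hs'
      have : (s' : Fin n →₀ ℕ) = s := by
        by_contra hne
        exact hs' (if_neg hne)
      exact this ▸ s'.2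
  intro s hs
  have := congrArg (MvPolynomial.coeff (s : Fin n →₀ ℕ)) hz
  rw [MvPolynomial.coeff_sum, Finset.sum_eq_single s] at this
  · simpa using this
  · intro s' _ hne
    rw [MvPolynomial.coeff_monomial, if_neg fun h => hne (Subtype.ext h)]
  · exact fun h => absurd hs h

theorem mk_mem_span (h : IsReducedGroebnerBasis m I 𝒢) (f : MvPolynomial (Fin n) K) :
    Ideal.Quotient.mk I f ∈ Submodule.span K (Set.range fun s : staircase m 𝒢 =>
      Ideal.Quotient.mk I (MvPolynomial.monomial (s : Fin n →₀ ℕ) 1)) := by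
  obtain ⟨r, h1, h2⟩ := h.exists_normalForm f
  rw [Ideal.Quotient.mk_eq_mk_iff_sub_mem f r |>.2 h1, ← MvPolynomial.support_sum_monomial_coeff r,
    map_sum]
  refine Submodule.sum_mem _ fun s hs => ?_
  have : Ideal.Quotient.mk I (MvPolynomial.monomial s (r.coeff s))
      = r.coeff s • Ideal.Quotient.mk I (MvPolynomial.monomial s 1) := by
    rw [← Ideal.Quotient.mkₐ_eq_mk K, ← map_smul, MvPolynomial.smul_monomial, smul_eq_mul, mul_one]
  rw [this]
  exact Submodule.smul_mem _ _ (Submodule.subset_span ⟨⟨s, h2 s hs⟩, rfl⟩)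

/-- The monomials of the staircase form a basis of the quotient. -/
def basis (h : IsReducedGroebnerBasis m I 𝒢) :
    Module.Basis (staircase m 𝒢) K (MvPolynomial (Fin n) K ⧸ I) :=
  Module.Basis.mk h.linearIndependent fun x _ => by
    obtain ⟨f, rfl⟩ := Ideal.Quotient.mk_surjective x
    exact h.mk_mem_span f

theorem basis_apply (h : IsReducedGroebnerBasis m I 𝒢) (s : staircase m 𝒢) :
    h.basis s = Ideal.Quotient.mk I (MvPolynomial.monomial (s : Fin n →₀ ℕ) 1) := by
  rw [basis, Module.Basis.mk_apply]

theorem degree_ne_zero (h : IsReducedGroebnerBasis m I 𝒢) (hI : I ≠ ⊤)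
    {g : MvPolynomial (Fin n) K} (hg : g ∈ 𝒢) : m.degree g ≠ 0 := by
  intro h0
  have h1 := m.eq_C_of_degree_eq_zero h0
  rw [(h.1 g hg).2.leadingCoeff_eq_one, map_one] at h1
  exact hI ((Ideal.eq_top_iff_one I).2 (h1 ▸ (h.1 g hg).1))

theorem zero_mem_staircase (h : IsReducedGroebnerBasis m I 𝒢) (hI : I ≠ ⊤) :
    0 ∈ staircase m 𝒢 := fun _ hg hle =>
  h.degree_ne_zero hI hg (le_antisymm hle _root_.zero_le)

/-- Since the ideal is proper, 1 is not a leading monomial, and a variable has no divisors other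
than 1 and itself. -/
theorem single_mem (h : IsReducedGroebnerBasis m I 𝒢) (hI : I ≠ ⊤) (i : Fin n)
    (hi : Finsupp.single i 1 ∉ staircase m 𝒢) : Finsupp.single i 1 ∈ leadingMonomials m 𝒢 := by
  simp only [staircase, Set.mem_ofPred_eq, not_forall, not_not] at hi
  obtain ⟨g, hg, hle⟩ := hi
  refine ⟨g, hg, ?_⟩
  have h0 := h.degree_ne_zero hI hg
  ext j
  have hj := hle j
  by_cases hij : j = i
  · subst hij
    by_contra hne
    apply h0
    ext l
    have hl := hle l
    by_cases hlj : l = j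
    · subst hlj
      simp at hl hne ⊢; omega
    · rw [Finsupp.single_apply, if_neg (Ne.symm hlj)] at hl
      simpa using hl
  · rw [Finsupp.single_apply, if_neg (Ne.symm hij)] at hj ⊢
    omega

end IsReducedGroebnerBasis

/-! ### Diagonal actions -/

theorem monomialWeight_add (A : GL (Fin n) K) (s t : Fin n →₀ ℕ) :
    monomialWeight A (s + t) = monomialWeight A s * monomialWeight A t := by
  simp [monomialWeight, pow_add, Finset.prod_mul_distrib]

theorem monomialWeight_zero (A : GL (Fin n) K) : monomialWeight A 0 = 1 := by
  simp [monomialWeight]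

theorem monomialWeight_single (A : GL (Fin n) K) (i : Fin n) (j : ℕ) :
    monomialWeight A (Finsupp.single i j) = (A : Matrix (Fin n) (Fin n) K) i i ^ j := by
  rw [monomialWeight, Finset.prod_eq_single i]
  · simp
  · intro l _ hl
    rw [Finsupp.single_apply, if_neg hl.symm, pow_zero]
  · simp

theorem diag_entry_ne_zero {A : GL (Fin n) K} (hA : (A : Matrix (Fin n) (Fin n) K).IsDiag)
    (i : Fin n) : (A : Matrix (Fin n) (Fin n) K) i i ≠ 0 := by
  have h := (Matrix.isUnit_iff_isUnit_det _).1 A.isUnit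
  rw [← hA.diagonal_diag, Matrix.det_diagonal] at h
  exact Finset.prod_ne_zero_iff.1 h.ne_zero i (Finset.mem_univ i)

theorem monomialWeight_ne_zero {A : GL (Fin n) K} (hA : (A : Matrix (Fin n) (Fin n) K).IsDiag)
    (s : Fin n →₀ ℕ) : monomialWeight A s ≠ 0 :=
  Finset.prod_ne_zero_iff.2 fun i _ => pow_ne_zero _ (diag_entry_ne_zero hA i)

theorem matrixAct_monomial {A : GL (Fin n) K} (hA : (A : Matrix (Fin n) (Fin n) K).IsDiag)
    (s : Fin n →₀ ℕ) (a : K) : matrixAct A (MvPolynomial.monomial s a)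
      = MvPolynomial.monomial s (monomialWeight A s * a) := by
  have h : ∀ i, ∑ j, MvPolynomial.C ((A : Matrix (Fin n) (Fin n) K) i j) * MvPolynomial.X j
      = (MvPolynomial.C ((A : Matrix (Fin n) (Fin n) K) i i) * MvPolynomial.X i :
        MvPolynomial (Fin n) K) := by
    intro i
    rw [Finset.sum_eq_single i]
    · intro j _ hj
      rw [hA hj.symm, map_zero, zero_mul]
    · simp
  rw [matrixAct, MvPolynomial.aeval_monomial, MvPolynomial.monomial_eq (a := monomialWeight A s * a),
    Finsupp.prod_fintype _ _ (fun i => pow_zero _), Finsupp.prod_fintype _ _ (fun i => pow_zero _)]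
  simp only [h, mul_pow, Finset.prod_mul_distrib]
  rw [monomialWeight, map_mul, map_prod, MvPolynomial.algebraMap_eq]
  simp only [map_pow]
  ring

theorem coeff_matrixAct {A : GL (Fin n) K} (hA : (A : Matrix (Fin n) (Fin n) K).IsDiag)
    (f : MvPolynomial (Fin n) K) (s : Fin n →₀ ℕ) :
    (matrixAct A f).coeff s = monomialWeight A s * f.coeff s := by
  induction f using MvPolynomial.induction_on' with
  | monomial t a =>
    rw [matrixAct_monomial hA, MvPolynomial.coeff_monomial, MvPolynomial.coeff_monomial]
    split_ifs with h
    · rw [h]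
    · simp
  | add p q hp hq => rw [map_add, MvPolynomial.coeff_add, MvPolynomial.coeff_add, hp, hq, mul_add]

/-- A polynomial of the ideal all of whose monomials but one lie in the staircase is homogeneous. -/
theorem IsReducedGroebnerBasis.sameGDegree (h : IsReducedGroebnerBasis m I 𝒢)
    {G : Subgroup (GL (Fin n) K)} (hG : ∀ A ∈ G, (A : Matrix (Fin n) (Fin n) K).IsDiag)
    (hI : IsInvariantUnder I G) {f : MvPolynomial (Fin n) K} (hf : f ∈ I) {s₀ : Fin n →₀ ℕ}
    (hs : ∀ s ∈ f.support, s ≠ s₀ → s ∈ staircase m 𝒢) {s : Fin n →₀ ℕ} (hsf : f.coeff s ≠ 0) :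
    SameGDegree G s s₀ := by
  intro A hA
  -- This combination lies in the ideal by invariance and has lost the monomial `s₀`; it is
  -- supported on the staircase, hence zero, so that every monomial of `f` has the weight of `s₀`.
  have hc : ∀ t, (matrixAct A f - MvPolynomial.C (monomialWeight A s₀) * f).coeff t
      = (monomialWeight A t - monomialWeight A s₀) * f.coeff t := by
    intro t
    rw [MvPolynomial.coeff_sub, MvPolynomial.coeff_C_mul, coeff_matrixAct (hG A hA)]; ring
  have h0 := h.eq_zero_of_support (I.sub_mem (hI A hA f hf) (I.mul_mem_left _ hf))
    fun t ht => by
      rw [MvPolynomial.mem_support_iff, hc] at ht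
      refine hs t (MvPolynomial.mem_support_iff.2 (right_ne_zero_of_mul ht)) ?_
      rintro rfl
      exact left_ne_zero_of_mul ht (sub_self _)
  have h1 := hc s
  rw [h0, MvPolynomial.coeff_zero] at h1
  exact sub_eq_zero.1 ((mul_eq_zero.1 h1.symm).resolve_right hsf)

/-! ### Congruence properties of the G-degree -/

section Degrees

variable {G : Subgroup (GL (Fin n) K)} {s t s' t' : Fin n →₀ ℕ}

theorem SameGDegree.symm (h : SameGDegree G s t) : SameGDegree G t s := fun A hA => (h A hA).symm

theorem SameGDegree.trans (h : SameGDegree G s t) (h' : SameGDegree G t t') : SameGDegree G s t' :=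
  fun A hA => (h A hA).trans (h' A hA)

theorem SameGDegree.add (h : SameGDegree G s t) (h' : SameGDegree G s' t') :
    SameGDegree G (s + s') (t + t') := fun A hA => by
  rw [monomialWeight_add, monomialWeight_add, h A hA, h' A hA]

theorem SameGDegree.of_add_right (hG : ∀ A ∈ G, (A : Matrix (Fin n) (Fin n) K).IsDiag)
    (h : SameGDegree G (s + s') (t + s')) : SameGDegree G s t := fun A hA => by
  have := h A hA
  rw [monomialWeight_add, monomialWeight_add] at this
  exact mul_right_cancel₀ (monomialWeight_ne_zero (hG A hA) s') this

end Degrees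

/-! ### Tables and linear forms -/

theorem tableBracket_eq (φ : MvPolynomial (Fin n) K →ₗ[K] K) (f : MvPolynomial (Fin n) K) :
    tableBracket (fun s => φ (MvPolynomial.monomial s 1)) f = φ f := by
  conv_rhs => rw [← MvPolynomial.support_sum_monomial_coeff f]
  rw [map_sum, tableBracket]
  refine Finset.sum_congr rfl fun s _ => ?_
  rw [← smul_eq_mul, ← map_smul, MvPolynomial.smul_monomial, smul_eq_mul, mul_one]

/-- The table of a linear form on the quotient. -/
def quotientTable (φ : (MvPolynomial (Fin n) K ⧸ I) →ₗ[K] K) (s : Fin n →₀ ℕ) : K :=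
  φ (Ideal.Quotient.mk I (MvPolynomial.monomial s 1))

theorem isCRelation_quotientTable (φ : (MvPolynomial (Fin n) K ⧸ I) →ₗ[K] K)
    {f : MvPolynomial (Fin n) K} (hf : f ∈ I) : IsCRelation (quotientTable φ) f := by
  intro i
  refine (tableBracket_eq (φ ∘ₗ (Ideal.Quotient.mkₐ K I).toLinearMap) _).trans ?_
  change φ (Ideal.Quotient.mk I _) = 0
  rw [Ideal.Quotient.eq_zero_iff_mem.2 (I.mul_mem_right _ hf), map_zero]

theorem tableBracket_mul_monomial (u : (Fin n →₀ ℕ) → K) (f : MvPolynomial (Fin n) K)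
    (t : Fin n →₀ ℕ) : tableBracket u (f * MvPolynomial.monomial t 1)
      = ∑ s ∈ f.support, f.coeff s * u (s + t) := by
  have hlin : ∀ g, tableBracket u g = ∑ s ∈ g.support, g.coeff s * u s := fun _ => rfl
  rw [hlin, ← Finset.sum_image (f := fun s => (f * MvPolynomial.monomial t 1).coeff s * u s)
    (g := fun s => s + t) (s := f.support) (fun a _ b _ h => add_right_cancel h)
    |>.trans (Finset.sum_congr rfl fun s _ => by rw [MvPolynomial.coeff_mul_monomial, mul_one])]
  refine Finset.sum_subset (fun s hs => ?_) fun s _ hs => ?_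
  · rw [MvPolynomial.mem_support_iff, MvPolynomial.coeff_mul_monomial'] at hs
    have hts : t ≤ s := by
      by_contra hts
      exact hs (if_neg hts)
    rw [if_pos hts, mul_one] at hs
    exact Finset.mem_image.2 ⟨s - t, MvPolynomial.mem_support_iff.2 hs, tsub_add_cancel_of_le hts⟩
  · rw [MvPolynomial.notMem_support_iff.1 hs, zero_mul]

end GroebnerBasis

/-! ### Shape position -/

/-- The powers of the last variable. -/
def lastPow (n j : ℕ) : Fin (n + 1) →₀ ℕ := Finsupp.single (Fin.last n) j

theorem lastPow_add (n j k : ℕ) : lastPow n (j + k) = lastPow n j + lastPow n k :=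
  Finsupp.single_add _ _ _

theorem lastPow_zero (n : ℕ) : lastPow n 0 = 0 := Finsupp.single_zero _

theorem lastPow_injective (n : ℕ) : Function.Injective (lastPow n) := Finsupp.single_injective _

theorem lastPow_last (n j : ℕ) : lastPow n j (Fin.last n) = j := Finsupp.single_eq_same

/-- The leading monomials of a basis in shape position. -/
def shapeLead (n D : ℕ) (i : Fin (n + 1)) : Fin (n + 1) →₀ ℕ :=
  Finsupp.single i (if i = Fin.last n then D else 1)

theorem shapeLead_last (n D : ℕ) : shapeLead n D (Fin.last n) = lastPow n D := by
  simp [shapeLead, lastPow]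

theorem shapeLead_of_ne {n D : ℕ} {i : Fin (n + 1)} (hi : i ≠ Fin.last n) :
    shapeLead n D i = Finsupp.single i 1 := by
  simp [shapeLead, hi]

section Shape

variable {n D : ℕ} {K : Type*} [Field K]

/-- The terms of a shape polynomial other than the leading one. -/
def shapeTail (D : ℕ) (c : Fin D → K) : MvPolynomial (Fin (n + 1)) K :=
  ∑ j : Fin D, MvPolynomial.monomial (lastPow n j) (c j)

theorem shapePolynomial_eq (i : Fin (n + 1)) (c : Fin D → K) :
    shapePolynomial D i c = MvPolynomial.monomial (shapeLead n D i) 1 + shapeTail D c := by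
  rw [shapePolynomial, shapeTail, shapeLead, ← MvPolynomial.X_pow_eq_monomial]
  congr 1
  refine Finset.sum_congr rfl fun j _ => ?_
  rw [MvPolynomial.X_pow_eq_monomial, MvPolynomial.C_mul_monomial, mul_one, lastPow]

theorem coeff_shapeTail_lastPow (c : Fin D → K) (j : Fin D) :
    (shapeTail D c : MvPolynomial (Fin (n + 1)) K).coeff (lastPow n j) = c j := by
  rw [shapeTail, MvPolynomial.coeff_sum, Finset.sum_eq_single j]
  · simp
  · intro l _ hl
    rw [MvPolynomial.coeff_monomial, if_neg fun h => hl (Fin.ext (lastPow_injective n h))]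
  · simp

theorem exists_of_coeff_shapeTail {c : Fin D → K} {s : Fin (n + 1) →₀ ℕ}
    (hs : (shapeTail D c).coeff s ≠ 0) : ∃ j < D, s = lastPow n j := by
  rw [shapeTail, MvPolynomial.coeff_sum] at hs
  obtain ⟨j, -, hj⟩ := Finset.exists_ne_zero_of_sum_ne_zero hs
  rw [MvPolynomial.coeff_monomial] at hj
  exact ⟨j, j.2, by by_contra hne; exact hj (if_neg fun h => hne h.symm)⟩

theorem lastPow_lt_shapeLead (i : Fin (n + 1)) {j : ℕ} (hj : j < D) :
    MonomialOrder.lex.toSyn (lastPow n j) < MonomialOrder.lex.toSyn (shapeLead n D i) := by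
  rw [MonomialOrder.lex_lt_iff]
  refine ⟨i, fun l hl => ?_, ?_⟩
  · change lastPow n j l = shapeLead n D i l
    have h1 : l ≠ Fin.last n := (hl.trans_le (Fin.le_last i)).ne
    rw [lastPow, shapeLead, Finsupp.single_apply, Finsupp.single_apply, if_neg h1.symm,
      if_neg hl.ne']
  · change lastPow n j i < shapeLead n D i i
    by_cases hi : i = Fin.last n
    · subst hi
      rw [shapeLead_last, lastPow_last, lastPow_last]; exact hj
    · rw [shapeLead_of_ne hi, lastPow, Finsupp.single_apply, if_neg (Ne.symm hi)]
      simp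

theorem degree_shapePolynomial (i : Fin (n + 1)) (c : Fin D → K) :
    MonomialOrder.lex.degree (shapePolynomial D i c) = shapeLead n D i := by
  classical
  have hne : ∀ s, (shapeTail D c).coeff s ≠ 0 →
      MonomialOrder.lex.toSyn s < MonomialOrder.lex.toSyn (shapeLead n D i) := by
    intro s hs
    obtain ⟨j, hj, rfl⟩ := exists_of_coeff_shapeTail hs
    exact lastPow_lt_shapeLead i hj
  have hlead : (shapePolynomial D i c).coeff (shapeLead n D i) = 1 := by
    rw [shapePolynomial_eq, MvPolynomial.coeff_add, MvPolynomial.coeff_monomial, if_pos rfl]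
    have : (shapeTail D c).coeff (shapeLead n D i) = 0 := by
      by_contra h
      exact lt_irrefl _ (hne _ h)
    rw [this, add_zero]
  refine MonomialOrder.lex.toSyn.injective (le_antisymm ?_ ?_)
  · rw [MonomialOrder.degree_le_iff]
    intro s hs
    rw [MvPolynomial.mem_support_iff, shapePolynomial_eq, MvPolynomial.coeff_add,
      MvPolynomial.coeff_monomial] at hs
    by_cases h : shapeLead n D i = s
    · rw [h]
    · rw [if_neg h, zero_add] at hs
      exact (hne s hs).le
  · exact MonomialOrder.lex.le_degree (MvPolynomial.mem_support_iff.2 (by rw [hlead]; simp))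

theorem leadingMonomials_shapeBasis (c : Fin (n + 1) → Fin D → K) :
    leadingMonomials MonomialOrder.lex (shapeBasis D c) = Set.range (shapeLead n D) := by
  rw [leadingMonomials, shapeBasis, ← Set.range_comp]
  exact congrArg Set.range (funext fun i => degree_shapePolynomial i (c i))

theorem staircase_shapeBasis (c : Fin (n + 1) → Fin D → K) :
    staircase MonomialOrder.lex (shapeBasis D c) = lastPow n '' Set.Iio D := by
  ext s
  have h1 : s ∈ staircase MonomialOrder.lex (shapeBasis D c) ↔ ∀ i, ¬ shapeLead n D i ≤ s := by
    refine ⟨fun h i => ?_, ?_⟩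
    · rw [← degree_shapePolynomial i (c i)]
      exact h _ ⟨i, rfl⟩
    · rintro h _ ⟨i, rfl⟩
      simpa only [degree_shapePolynomial] using h i
  rw [h1]
  constructor
  · intro h
    refine ⟨s (Fin.last n), ?_, ?_⟩
    · have := h (Fin.last n)
      rw [shapeLead_last, lastPow, Finsupp.single_le_iff] at this
      exact Set.mem_Iio.2 (by omega)
    · ext i
      by_cases hi : i = Fin.last n
      · subst hi; exact lastPow_last n _
      · have := h i
        rw [shapeLead_of_ne hi, Finsupp.single_le_iff] at this
        rw [lastPow, Finsupp.single_apply, if_neg (Ne.symm hi)]; omega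
  · rintro ⟨j, hj, rfl⟩ i hle
    exact absurd (MonomialOrder.lex.toSyn_monotone hle)
      (not_le_of_gt (lastPow_lt_shapeLead i (Set.mem_Iio.1 hj)))

end Shape

/-! ### The combinatorial data of an invariant ideal in shape position -/

section Combinatorics

variable (n D : ℕ) (R : (Fin (n + 1) →₀ ℕ) → (Fin (n + 1) →₀ ℕ) → Prop)

/-- The order of the degree of the last variable. -/
def lastPeriod : ℕ := sInf {j | 0 < j ∧ R (lastPow n j) 0}

/-- The number of monomials of degree zero in the staircase. -/
def zeroCount : ℕ := (D - 1) / lastPeriod n R + 1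

/-- The remainder of `D - 1` by the period. -/
def baseExponent : ℕ := (D - 1) % lastPeriod n R

/-- The exponents of the last variable in the table terms that form the Hankel matrix. -/
def seqExponent (j : ℕ) : ℕ := baseExponent n D R + lastPeriod n R * j

/-- The degree of `x_i` is the degree of a power of the last variable. -/
def HasShift (i : Fin (n + 1)) : Prop :=
  ∃ t < lastPeriod n R, R (shapeLead n D i + lastPow n t) (lastPow n (baseExponent n D R))

/-- The power of the last variable that moves the leading monomial of index `i` to the degree of
the table terms that form the Hankel matrix. -/
def shiftExponent (i : Fin (n + 1)) : ℕ :=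
  open Classical in
  if i = Fin.last n then lastPeriod n R - 1 else if h : HasShift n D R i then h.choose else 0

/-- The indices of the table terms on the right-hand side of the Hankel system of index `i`. -/
def rhsIndex (i : Fin (n + 1)) (j : ℕ) : Fin (n + 1) →₀ ℕ :=
  open Classical in
  if i = Fin.last n then lastPow n (seqExponent n D R (zeroCount n D R + j))
  else if HasShift n D R i then
    shapeLead n D i + lastPow n (shiftExponent n D R i + lastPeriod n R * j)
  else lastPow n (seqExponent n D R 0)

/-- The indices of the table terms used by the algorithm. -/
def usedTerms : Finset (Fin (n + 1) →₀ ℕ) :=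
  open Classical in
  (Finset.range (2 * zeroCount n D R)).image (fun j => lastPow n (seqExponent n D R j)) ∪
    (Finset.univ ×ˢ Finset.range (zeroCount n D R)).image
      fun z : Fin n × ℕ => rhsIndex n D R z.1.castSucc z.2

/-- The last variable contributes no terms of its own: its right-hand side consists of the sequence
terms of indices `N, ..., 2N - 1`, for `N = zeroCount n D R`. -/
theorem card_usedTerms_le :
    (usedTerms n D R).card ≤ 2 * zeroCount n D R + n * zeroCount n D R := by
  classical
  refine (Finset.card_union_le _ _).trans (add_le_add ?_ ?_)
  · exact Finset.card_image_le.trans (by simp)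
  · exact Finset.card_image_le.trans (by simp)

theorem seq_mem_usedTerms {j : ℕ} (hj : j < 2 * zeroCount n D R) :
    lastPow n (seqExponent n D R j) ∈ usedTerms n D R := by
  classical
  exact Finset.mem_union_left _ (Finset.mem_image.2 ⟨j, Finset.mem_range.2 hj, rfl⟩)

theorem rhs_mem_usedTerms (i : Fin (n + 1)) {j : ℕ} (hj : j < zeroCount n D R) :
    rhsIndex n D R i j ∈ usedTerms n D R := by
  classical
  by_cases hi : i = Fin.last n
  · rw [rhsIndex, if_pos hi]
    exact seq_mem_usedTerms n D R (by omega)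
  · obtain ⟨i', rfl⟩ := Fin.exists_castSucc_eq.2 hi
    exact Finset.mem_union_right _ (Finset.mem_image.2 ⟨(i', j), by simpa using hj, rfl⟩)

/-- The offset is chosen so that the last of the exponents b + dk, k < N, is exactly D - 1. This
makes the Hankel matrix antitriangular for a suitable linear form, and makes all shifted
coefficients fit into N columns. -/
theorem baseExponent_add :
    D - 1 = baseExponent n D R + lastPeriod n R * (zeroCount n D R - 1) := by
  rw [zeroCount, Nat.add_sub_cancel, baseExponent, Nat.mod_add_div]

end Combinatorics

/-- The hypotheses on an invariant ideal in shape position, without the even splitting. -/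
structure ShapeSetting {n D : ℕ} (E : Finset (Fin (n + 1) →₀ ℕ))
    (R : (Fin (n + 1) →₀ ℕ) → (Fin (n + 1) →₀ ℕ) → Prop) {K : Type*} [Field K]
    (G : Subgroup (GL (Fin (n + 1)) K)) (I : Ideal (MvPolynomial (Fin (n + 1)) K))
    (𝒢 : Set (MvPolynomial (Fin (n + 1)) K)) (c : Fin (n + 1) → Fin D → K) : Prop where
  finite : Finite G
  diag : ∀ A ∈ G, (A : Matrix (Fin (n + 1)) (Fin (n + 1)) K).IsDiag
  rel_iff : ∀ s t, SameGDegree G s t ↔ R s t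
  zeroDim : IsZeroDimensional I
  degree_eq : idealDegree I = D
  invariant : IsInvariantUnder I G
  drl_basis : IsReducedGroebnerBasis (drl (n + 1)) I 𝒢
  lex_basis : IsReducedGroebnerBasis MonomialOrder.lex I (shapeBasis D c)
  propertyM : PropertyM 𝒢
  staircase_eq : staircase (drl (n + 1)) 𝒢 = (E : Set (Fin (n + 1) →₀ ℕ))

/-! ### Degrees of monomials, sizes of degree classes and the number of table terms -/

namespace ShapeSetting

variable {n D : ℕ} {E : Finset (Fin (n + 1) →₀ ℕ)}
  {R : (Fin (n + 1) →₀ ℕ) → (Fin (n + 1) →₀ ℕ) → Prop} {K : Type*} [Field K]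
  {G : Subgroup (GL (Fin (n + 1)) K)} {I : Ideal (MvPolynomial (Fin (n + 1)) K)}
  {𝒢 : Set (MvPolynomial (Fin (n + 1)) K)} {c : Fin (n + 1) → Fin D → K}

theorem degree_pos (S : ShapeSetting E R G I 𝒢 c) : 0 < D := by
  have h1 := S.zeroDim.2
  have : Nontrivial (MvPolynomial (Fin (n + 1)) K ⧸ I) :=
    Ideal.Quotient.nontrivial_iff.2 S.zeroDim.1
  rw [← S.degree_eq, idealDegree]
  exact Module.finrank_pos

theorem rel_refl (S : ShapeSetting E R G I 𝒢 c) (s) : R s s :=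
  (S.rel_iff s s).1 fun _ _ => rfl

theorem rel_symm (S : ShapeSetting E R G I 𝒢 c) {s t} (h : R s t) : R t s :=
  (S.rel_iff t s).1 ((S.rel_iff s t).2 h).symm

theorem rel_trans (S : ShapeSetting E R G I 𝒢 c) {s t t'} (h : R s t) (h' : R t t') : R s t' :=
  (S.rel_iff s t').1 (((S.rel_iff s t).2 h).trans ((S.rel_iff t t').2 h'))

theorem rel_add (S : ShapeSetting E R G I 𝒢 c) {s t s' t'} (h : R s t) (h' : R s' t') :
    R (s + s') (t + t') :=
  (S.rel_iff _ _).1 (((S.rel_iff s t).2 h).add ((S.rel_iff s' t').2 h'))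

theorem rel_of_add_right (S : ShapeSetting E R G I 𝒢 c) {s t s'} (h : R (s + s') (t + s')) :
    R s t :=
  (S.rel_iff _ _).1 (((S.rel_iff _ _).2 h).of_add_right S.diag)

/-- The order of the group is one of the exponents in the infimum, because A^|G| = 1 and a diagonal
entry of a power is the power of the entry. So the infimum is attained and is not the default value
0. -/
theorem period_spec (S : ShapeSetting E R G I 𝒢 c) :
    0 < lastPeriod n R ∧ R (lastPow n (lastPeriod n R)) 0 ∧ lastPeriod n R ≤ Nat.card G := by
  have := S.finite
  have hmem : Nat.card G ∈ {j | 0 < j ∧ R (lastPow n j) 0} := by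
    refine ⟨Nat.card_pos, (S.rel_iff _ _).1 fun A hA => ?_⟩
    rw [monomialWeight_zero, lastPow, monomialWeight_single]
    have h1 : A ^ Nat.card G = 1 :=
      congrArg Subtype.val (pow_card_eq_one' (x := (⟨A, hA⟩ : G)))
    have h2 := congrArg (fun B : GL (Fin (n + 1)) K =>
      (B : Matrix (Fin (n + 1)) (Fin (n + 1)) K) (Fin.last n) (Fin.last n)) h1
    simp only [Units.val_pow_eq_pow_val, Units.val_one, Matrix.one_apply_eq] at h2
    rw [← (S.diag A hA).diagonal_diag, Matrix.diagonal_pow, Matrix.diagonal_apply_eq] at h2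
    exact h2
  have h := Nat.sInf_mem ⟨_, hmem⟩
  exact ⟨h.1, h.2, Nat.sInf_le hmem⟩

theorem rel_mul_period (S : ShapeSetting E R G I 𝒢 c) (j : ℕ) :
    R (lastPow n (lastPeriod n R * j)) 0 := by
  induction j with
  | zero => rw [mul_zero, lastPow_zero]; exact S.rel_refl 0
  | succ j ih =>
    rw [Nat.mul_succ, lastPow_add, ← add_zero (0 : Fin (n + 1) →₀ ℕ)]
    exact S.rel_add ih S.period_spec.2.1

theorem rel_zero_iff (S : ShapeSetting E R G I 𝒢 c) (j : ℕ) :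
    R (lastPow n j) 0 ↔ lastPeriod n R ∣ j := by
  constructor
  · intro h
    by_contra hd
    have h1 : R (lastPow n (j % lastPeriod n R)) 0 := by
      have h2 : R (lastPow n (j % lastPeriod n R) + lastPow n (lastPeriod n R * (j / lastPeriod n R)))
          (0 + lastPow n (lastPeriod n R * (j / lastPeriod n R))) := by
        rw [← lastPow_add, Nat.mod_add_div, zero_add]
        exact S.rel_trans h (S.rel_symm (S.rel_mul_period _))
      exact S.rel_of_add_right h2
    have h3 := Nat.sInf_le (s := {j | 0 < j ∧ R (lastPow n j) 0})
      ⟨Nat.pos_of_ne_zero fun h0 => hd (Nat.dvd_of_mod_eq_zero h0), h1⟩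
    exact absurd (Nat.mod_lt j S.period_spec.1) (not_lt_of_ge h3)
  · rintro ⟨k, rfl⟩
    exact S.rel_mul_period k

theorem rel_lastPow_iff (S : ShapeSetting E R G I 𝒢 c) (a b : ℕ) :
    R (lastPow n a) (lastPow n b) ↔ a ≡ b [MOD lastPeriod n R] := by
  wlog hab : a ≤ b generalizing a b
  · rw [Nat.ModEq.comm, ← this b a (by omega)]
    exact ⟨S.rel_symm, S.rel_symm⟩
  obtain ⟨l, rfl⟩ := Nat.exists_eq_add_of_le hab
  have h1 : a ≡ a + l [MOD lastPeriod n R] ↔ lastPeriod n R ∣ l := by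
    rw [Nat.modEq_iff_dvd' hab, Nat.add_sub_cancel_left]
  rw [h1, ← S.rel_zero_iff, lastPow_add]
  constructor
  · intro h
    refine S.rel_symm (S.rel_of_add_right (s' := lastPow n a) ?_)
    rwa [zero_add, add_comm]
  · intro h
    have := S.rel_add (S.rel_refl (lastPow n a)) (S.rel_symm h)
    rwa [add_zero] at this

/-- There are at most `zeroCount` exponents below `D` that are congruent modulo the period. -/
theorem card_filter_range_le (p : ℕ → Prop) [DecidablePred p]
    (hp : ∀ a b, p a → p b → a ≡ b [MOD lastPeriod n R]) :
    ((Finset.range D).filter p).card ≤ zeroCount n D R := by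
  calc ((Finset.range D).filter p).card ≤ (Finset.range (zeroCount n D R)).card :=
        -- Exponents with the same remainder are distinguished by their quotients.
        Finset.card_le_card_of_injOn (fun j => j / lastPeriod n R)
          (fun j hj => by
            have hj' : j < D := by
              have := (Finset.mem_filter.1 hj).1
              exact Finset.mem_range.1 this
            have : j / lastPeriod n R ≤ (D - 1) / lastPeriod n R :=
              Nat.div_le_div_right (by omega)
            exact Finset.mem_coe.2 (Finset.mem_range.2 (Nat.lt_succ_of_le this)))
          (fun a ha b hb hab => by
            have h1 := hp a b (Finset.mem_filter.1 ha).2 (Finset.mem_filter.1 hb).2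
            have h2 : a / lastPeriod n R = b / lastPeriod n R := hab
            rw [← Nat.mod_add_div a (lastPeriod n R), ← Nat.mod_add_div b (lastPeriod n R), h2]
            exact congrArg (· + _) h1)
    _ = zeroCount n D R := Finset.card_range _

/-- The normal form of a monomial for the `LEX` basis is homogeneous. -/
theorem exists_homogeneous_normalForm (S : ShapeSetting E R G I 𝒢 c) (s : Fin (n + 1) →₀ ℕ) :
    ∃ r : MvPolynomial (Fin (n + 1)) K, MvPolynomial.monomial s 1 - r ∈ I ∧
      ∀ t ∈ r.support, ∃ j < D, t = lastPow n j ∧ R t s := by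
  classical
  obtain ⟨r, h1, h2⟩ := S.lex_basis.exists_normalForm (MvPolynomial.monomial s 1)
  refine ⟨r, h1, fun t ht => ?_⟩
  have h3 := h2 t ht
  rw [staircase_shapeBasis] at h3
  obtain ⟨j, hj, rfl⟩ := h3
  refine ⟨j, hj, rfl, ?_⟩
  by_cases hts : lastPow n j = s
  · rw [hts]; exact S.rel_refl s
  · refine (S.rel_iff _ _).1 (S.lex_basis.sameGDegree S.diag S.invariant h1 (s₀ := s)
      (fun t' ht' hne => h2 t' ?_) ?_)
    · rw [MvPolynomial.mem_support_iff, MvPolynomial.coeff_sub, MvPolynomial.coeff_monomial,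
        if_neg (Ne.symm hne), zero_sub, neg_ne_zero] at ht'
      exact MvPolynomial.mem_support_iff.2 ht'
    · rw [MvPolynomial.coeff_sub, MvPolynomial.coeff_monomial, if_neg (Ne.symm hts), zero_sub,
        neg_ne_zero]
      exact MvPolynomial.mem_support_iff.1 ht

/-- Each degree contains at most `zeroCount` monomials of the `DRL` staircase. -/
theorem card_class_le (S : ShapeSetting E R G I 𝒢 c) (t : Fin (n + 1) →₀ ℕ)
    [DecidablePred fun s => R s t] : (E.filter fun s => R s t).card ≤ zeroCount n D R := by
  classical
  -- Modulo the ideal, the staircase monomials in the degree of `t` are combinations of the powers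
  -- of the last variable in that degree, by homogeneity of LEX normal forms. They are independent,
  -- so they are at most as many as these powers.
  set T := ((Finset.range D).filter fun j => R (lastPow n j) t) with hT
  have hT' : T.card ≤ zeroCount n D R := card_filter_range_le _ fun a b ha hb =>
    (S.rel_lastPow_iff a b).1 (S.rel_trans ha (S.rel_symm hb))
  refine le_trans ?_ hT'
  let v : ℕ → MvPolynomial (Fin (n + 1)) K ⧸ I := fun j =>
    Ideal.Quotient.mk I (MvPolynomial.monomial (lastPow n j) 1)
  have hli : LinearIndependent K fun s : (E.filter fun s => R s t) =>
      Ideal.Quotient.mk I (MvPolynomial.monomial (s : Fin (n + 1) →₀ ℕ) 1) := by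
    have := S.drl_basis.linearIndependent
    refine this.comp (fun s : (E.filter fun s => R s t) => (⟨s, by
      rw [S.staircase_eq]
      exact (Finset.mem_filter.1 s.2).1⟩ : staircase (drl (n + 1)) 𝒢)) fun a b hab => ?_
    exact Subtype.ext (congrArg (fun z : staircase (drl (n + 1)) 𝒢 => (z : Fin (n + 1) →₀ ℕ)) hab)
  have hsp : Set.range (fun s : (E.filter fun s => R s t) =>
      Ideal.Quotient.mk I (MvPolynomial.monomial (s : Fin (n + 1) →₀ ℕ) 1))
      ⊆ Submodule.span K (T.image v : Set (MvPolynomial (Fin (n + 1)) K ⧸ I)) := by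
    rintro _ ⟨s, rfl⟩
    obtain ⟨r, h1, h2⟩ := S.exists_homogeneous_normalForm (s : Fin (n + 1) →₀ ℕ)
    change Ideal.Quotient.mk I (MvPolynomial.monomial (s : Fin (n + 1) →₀ ℕ) 1) ∈ _
    rw [(Ideal.Quotient.mk_eq_mk_iff_sub_mem _ _).2 h1, ← MvPolynomial.support_sum_monomial_coeff r,
      map_sum]
    refine Submodule.sum_mem _ fun t' ht' => ?_
    have : Ideal.Quotient.mk I (MvPolynomial.monomial t' (r.coeff t'))
        = r.coeff t' • Ideal.Quotient.mk I (MvPolynomial.monomial t' 1) := by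
      rw [← Ideal.Quotient.mkₐ_eq_mk K, ← map_smul, MvPolynomial.smul_monomial, smul_eq_mul, mul_one]
    rw [this]
    obtain ⟨j, hj, rfl, hR⟩ := h2 t' ht'
    refine Submodule.smul_mem _ _ (Submodule.subset_span ?_)
    refine Finset.mem_coe.2 (Finset.mem_image_of_mem v (Finset.mem_filter.2
      ⟨Finset.mem_range.2 hj, S.rel_trans hR (Finset.mem_filter.1 s.2).2⟩))
  have h := linearIndependent_le_span_aux' _ hli _ hsp
  simp only [Fintype.card_coe] at h
  refine le_trans ?_ (Finset.card_image_le (s := T) (f := v))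
  simpa using h

theorem zero_mem (S : ShapeSetting E R G I 𝒢 c) : (0 : Fin (n + 1) →₀ ℕ) ∈ E := by
  have := S.drl_basis.zero_mem_staircase S.zeroDim.1
  rwa [S.staircase_eq] at this

/-- A monomial of the staircase with the largest exponent of the last variable leaves the staircase.
In the operation count this factor of at least 1 absorbs the terms in which it does not occur. -/
theorem card_nontrivialColumns_pos (S : ShapeSetting E R G I 𝒢 c) :
    0 < (nontrivialColumns E).card := by
  classical
  obtain ⟨s, hs, hmax⟩ := Finset.exists_max_image E (fun s => s (Fin.last n)) ⟨0, S.zero_mem⟩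
  refine Finset.card_pos.2 ⟨s, Finset.mem_filter.2 ⟨hs, fun h => ?_⟩⟩
  have := hmax _ h
  simp at this

theorem degreeZero_inter (S : ShapeSetting E R G I 𝒢 c) :
    staircase MonomialOrder.lex (shapeBasis D c) ∩ degreeZeroMonomials G
      = (fun j => lastPow n (lastPeriod n R * j)) '' Set.Iio (zeroCount n D R) := by
  have hd := S.period_spec.1
  have hD := S.degree_pos
  rw [staircase_shapeBasis]
  ext s
  constructor
  · rintro ⟨⟨j, hj, rfl⟩, h⟩
    obtain ⟨k, rfl⟩ := (S.rel_zero_iff j).1 ((S.rel_iff _ _).1 h)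
    refine ⟨k, ?_, rfl⟩
    have hj' : lastPeriod n R * k < D := hj
    have : k ≤ (D - 1) / lastPeriod n R := by
      rw [Nat.le_div_iff_mul_le hd, mul_comm]; omega
    exact Nat.lt_succ_of_le this
  · rintro ⟨k, hk, rfl⟩
    refine ⟨⟨_, ?_, rfl⟩, (S.rel_iff _ _).2 (S.rel_mul_period k)⟩
    have hk' : k ≤ (D - 1) / lastPeriod n R := Nat.le_of_lt_succ hk
    rw [Nat.le_div_iff_mul_le hd, mul_comm] at hk'
    exact Set.mem_Iio.2 (by omega)

theorem ncard_degreeZero (S : ShapeSetting E R G I 𝒢 c) :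
    (staircase MonomialOrder.lex (shapeBasis D c) ∩ degreeZeroMonomials G).ncard
      = zeroCount n D R := by
  rw [S.degreeZero_inter, Set.ncard_image_of_injective]
  · simp
  · intro a b hab
    exact Nat.eq_of_mul_eq_mul_left S.period_spec.1 (lastPow_injective n hab)

/-- The number of table terms is at most that of the statement. -/
theorem card_usedTerms_le_ncard (S : ShapeSetting E R G I 𝒢 c) :
    (usedTerms n D R).card ≤
      ((staircase MonomialOrder.lex (shapeBasis D c) ∩ degreeZeroMonomials G) +
        ((staircase MonomialOrder.lex (shapeBasis D c) ∩ degreeZeroMonomials G) ∪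
          leadingMonomials MonomialOrder.lex (shapeBasis D c))).ncard := by
  classical
  have hd := S.period_spec.1
  have hD := S.degree_pos
  set N := zeroCount n D R with hN
  have hlt : ∀ k < N, lastPeriod n R * k < D := by
    intro k hk
    have hk' : k ≤ (D - 1) / lastPeriod n R := Nat.le_of_lt_succ hk
    rw [Nat.le_div_iff_mul_le hd, mul_comm] at hk'
    omega
  rw [leadingMonomials_shapeBasis, S.degreeZero_inter, ← hN]
  set A := (fun j => lastPow n (lastPeriod n R * j)) '' Set.Iio N with hA
  have hAfin : A.Finite := (Set.finite_Iio N).image _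
  have hfin : (A + (A ∪ Set.range (shapeLead n D))).Finite :=
    hAfin.add (hAfin.union (Set.finite_range _))
  have hmem : ∀ k < N, lastPow n (lastPeriod n R * k) ∈ A := fun k hk => ⟨k, hk, rfl⟩
  have h0 : (0 : Fin (n + 1) →₀ ℕ) ∈ A := ⟨0, Set.mem_Iio.2 (Nat.succ_pos _), by
    simp [lastPow_zero]⟩
  -- Three disjoint families in the sumset: products with 1, with x^D and with the other leading
  -- monomials, where x is the last variable. Only cardinalities are compared: the terms used by the
  -- algorithm are moved to another degree and need not lie in the sumset.
  let B₁ := (Finset.range N).image fun k => lastPow n (lastPeriod n R * k)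
  let B₂ := (Finset.range N).image fun k => lastPow n (D + lastPeriod n R * k)
  let B₃ := (Finset.univ ×ˢ Finset.range N).image fun z : Fin n × ℕ =>
    lastPow n (lastPeriod n R * z.2) + Finsupp.single z.1.castSucc 1
  have hc₁ : B₁.card = N := by
    rw [Finset.card_image_of_injective, Finset.card_range]
    intro a b hab
    exact Nat.eq_of_mul_eq_mul_left hd (lastPow_injective n hab)
  have hc₂ : B₂.card = N := by
    rw [Finset.card_image_of_injective, Finset.card_range]
    intro a b hab
    exact Nat.eq_of_mul_eq_mul_left hd (Nat.add_left_cancel (lastPow_injective n hab))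
  have hlast : ∀ (i : Fin n) (j : ℕ),
      (lastPow n j + Finsupp.single i.castSucc 1 : Fin (n + 1) →₀ ℕ) (Fin.last n) = j := by
    intro i j
    rw [Finsupp.add_apply, lastPow_last, Finsupp.single_apply,
      if_neg (Fin.castSucc_lt_last i).ne, add_zero]
  have hcast : ∀ (i i' : Fin n) (j : ℕ),
      (lastPow n j + Finsupp.single i.castSucc 1 : Fin (n + 1) →₀ ℕ) i'.castSucc = if i = i' then 1 else 0 := by
    intro i i' j
    rw [Finsupp.add_apply, lastPow, Finsupp.single_apply, Finsupp.single_apply,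
      if_neg (Fin.castSucc_lt_last i').ne', zero_add]
    simp [Fin.castSucc_inj]
  have hc₃ : B₃.card = n * N := by
    rw [Finset.card_image_of_injective, Finset.card_product, Finset.card_univ, Fintype.card_fin,
      Finset.card_range]
    rintro ⟨i, a⟩ ⟨i', b⟩ hab
    have h1 := DFunLike.congr_fun hab (Fin.last n)
    have h2 := DFunLike.congr_fun hab i.castSucc
    simp only [hlast, hcast] at h1 h2
    have h3 : i = i' := by
      by_contra hne
      rw [if_pos trivial, if_neg (Ne.symm hne)] at h2
      exact one_ne_zero h2
    exact Prod.ext h3 (Nat.eq_of_mul_eq_mul_left hd h1)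
  have hd₁ : Disjoint B₁ B₂ := by
    rw [Finset.disjoint_left]
    intro s h1 h2
    obtain ⟨a, ha, rfl⟩ := Finset.mem_image.1 h1
    obtain ⟨b, -, hb⟩ := Finset.mem_image.1 h2
    have := lastPow_injective n hb
    have := hlt a (Finset.mem_range.1 ha)
    omega
  have hd₂ : Disjoint (B₁ ∪ B₂) B₃ := by
    rw [Finset.disjoint_right]
    intro s h1 h2
    obtain ⟨⟨i, a⟩, -, rfl⟩ := Finset.mem_image.1 h1
    have hz : ∀ j, lastPow n j ≠ lastPow n (lastPeriod n R * a) + Finsupp.single i.castSucc 1 := by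
      intro j hj
      have := DFunLike.congr_fun hj i.castSucc
      rw [hcast, if_pos rfl, lastPow, Finsupp.single_apply,
        if_neg (Fin.castSucc_lt_last i).ne'] at this
      exact zero_ne_one this
    rcases Finset.mem_union.1 h2 with h | h
    · obtain ⟨b, -, hb⟩ := Finset.mem_image.1 h
      exact hz _ hb
    · obtain ⟨b, -, hb⟩ := Finset.mem_image.1 h
      exact hz _ hb
  have hsub : ((B₁ ∪ B₂ ∪ B₃ : Finset _) : Set (Fin (n + 1) →₀ ℕ))
      ⊆ A + (A ∪ Set.range (shapeLead n D)) := by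
    intro s hs
    rcases Finset.mem_union.1 (Finset.mem_coe.1 hs) with h | h
    · rcases Finset.mem_union.1 h with h | h
      · obtain ⟨a, ha, rfl⟩ := Finset.mem_image.1 h
        exact ⟨_, hmem a (Finset.mem_range.1 ha), 0, Or.inl h0, add_zero _⟩
      · obtain ⟨a, ha, rfl⟩ := Finset.mem_image.1 h
        refine ⟨_, hmem a (Finset.mem_range.1 ha), _, Or.inr ⟨Fin.last n, rfl⟩, ?_⟩
        simp only [shapeLead_last, ← lastPow_add, add_comm D]
    · obtain ⟨⟨i, a⟩, ha, rfl⟩ := Finset.mem_image.1 h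
      refine ⟨_, hmem a (by simpa using ha), _, Or.inr ⟨i.castSucc, rfl⟩, ?_⟩
      simp only [shapeLead_of_ne (Fin.castSucc_lt_last i).ne]
  calc (usedTerms n D R).card ≤ 2 * N + n * N := card_usedTerms_le n D R
    _ = (B₁ ∪ B₂ ∪ B₃).card := by
        rw [Finset.card_union_of_disjoint hd₂, Finset.card_union_of_disjoint hd₁, hc₁, hc₂, hc₃]
        ring
    _ ≤ _ := by
        rw [← Set.ncard_coe_finset]
        exact Set.ncard_le_ncard hsub hfin

end ShapeSetting

/-! ### The computation of the table -/

/-- The input cells of the computation of the table. -/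
abbrev TableCell {n : ℕ} (E : Finset (Fin (n + 1) →₀ ℕ)) : Type :=
  ((Fin (n + 1) →₀ ℕ) × (Fin (n + 1) →₀ ℕ)) ⊕ E

section TableProgram

variable {n : ℕ} (D : ℕ) (E : Finset (Fin (n + 1) →₀ ℕ))
  (R : (Fin (n + 1) →₀ ℕ) → (Fin (n + 1) →₀ ℕ) → Prop)

/-- The monomials of the staircase in the degree of `t`. -/
def degreeClass (t : Fin (n + 1) →₀ ℕ) : Finset (Fin (n + 1) →₀ ℕ) :=
  open Classical in E.filter fun s => R s t

/-- The table term at `l` times a power of the last variable, from the basis element with leading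
monomial `l` and from known table terms. -/
def reducedTerm {K : Type*} [Field K] (x : TableCell E ⊕ (Fin (n + 1) →₀ ℕ) → K)
    (l : Fin (n + 1) →₀ ℕ) (a : ℕ) : K :=
  - ∑ s ∈ degreeClass E R l, x (Sum.inl (Sum.inl (l, s))) * x (Sum.inr (s + lastPow n a))

theorem computes_reducedTerm (l : Fin (n + 1) →₀ ℕ) (a : ℕ) :
    ComputesScalar.{u} (2 * (degreeClass E R l).card + 1)
      fun K _ (x : TableCell E ⊕ (Fin (n + 1) →₀ ℕ) → K) => reducedTerm E R x l a :=
  (ComputesScalar.sum_mul (degreeClass E R l) (fun s => (Sum.inl (Sum.inl (l, s)) :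
    TableCell E ⊕ (Fin (n + 1) →₀ ℕ))) fun s => Sum.inr (s + lastPow n a)).neg

/-- The table terms computed in step `j`. -/
def front (j : ℕ) : Finset (Fin (n + 1) →₀ ℕ) :=
  open Classical in
  ((nontrivialColumns E).image fun s => s + lastPow n (j + 1)).filter fun s =>
    R s (lastPow n (baseExponent n D R))

/-- The step `j` of the computation of the table. -/
def tableStep (j : ℕ) {K : Type*} [Field K] (x : TableCell E ⊕ (Fin (n + 1) →₀ ℕ) → K)
    (s : Fin (n + 1) →₀ ℕ) : K :=
  if s ∈ front D E R j then reducedTerm E R x (s - lastPow n j) j else x (Sum.inr s)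

/-- The known table terms after step `j`. -/
def tableState {K : Type*} [Field K] (x : TableCell E → K) : ℕ → (Fin (n + 1) →₀ ℕ) → K
  | 0 => fun s => if h : s ∈ E then x (Sum.inr ⟨s, h⟩) else 0
  | j + 1 => tableStep D E R j (Sum.elim x (tableState x j))

theorem computes_tableState (T : ℕ) :
    Computes.{u} (∑ j ∈ Finset.range T, ∑ s ∈ front D E R j,
        (2 * (degreeClass E R (s - lastPow n j)).card + 1))
      fun K _ (x : TableCell E → K) => tableState D E R x T := by
  have h0 : Computes.{u} 0 fun K _ (x : TableCell E → K) => tableState D E R x 0 :=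
    (Computes.select.{u} fun s => if h : s ∈ E then some (Sum.inr ⟨s, h⟩) else none).congr
      fun K _ x s => by
        by_cases h : s ∈ E <;> simp [tableState, h]
  have h := Computes.loop (f := fun T K _ (x : TableCell E → K) => tableState D E R x T)
    (g := fun j K _ x => tableStep D E R j x) h0
    (fun j => Computes.of_coords (f := fun K _ x => tableStep D E R j x) (front D E R j)
      (fun s => 2 * (degreeClass E R (s - lastPow n j)).card + 1) (fun s => some (Sum.inr s))
      (fun s hs => by
        simp only [tableStep, hs, if_true]
        exact computes_reducedTerm E R _ _)
      fun s hs K _ x => by simp [tableStep, hs]) (fun _ _ _ _ => rfl) T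
  simpa using h

/-- The number of steps of the computation of the table. -/
def tableSteps (n D : ℕ) (R : (Fin (n + 1) →₀ ℕ) → (Fin (n + 1) →₀ ℕ) → Prop) : ℕ :=
  D + lastPeriod n R * zeroCount n D R

/-- The monomial is that of a variable outside of the staircase times a power of the last
variable. -/
def IsOuter (q : Fin (n + 1) →₀ ℕ) (z : Fin (n + 1) × ℕ) : Prop :=
  z.1 ≠ Fin.last n ∧ Finsupp.single z.1 1 ∉ E ∧ q = Finsupp.single z.1 1 + lastPow n z.2

/-- The table terms used by the algorithm, from the known ones. -/
def tableFinish {K : Type*} [Field K] (x : TableCell E ⊕ (Fin (n + 1) →₀ ℕ) → K)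
    (q : usedTerms n D R) : K :=
  open Classical in
  if h : ∃ z, IsOuter E (q : Fin (n + 1) →₀ ℕ) z then
    reducedTerm E R x (Finsupp.single h.choose.1 1) h.choose.2
  else x (Sum.inr q)

/-- The table terms used by the algorithm, from the coefficients of the `DRL` basis. -/
def tableOutput {K : Type*} [Field K] (x : TableCell E → K) (q : usedTerms n D R) : K :=
  tableFinish D E R (Sum.elim x (tableState D E R x (tableSteps n D R))) q

/-- A bound for the number of operations of the computation of the table. -/
def tableCost : ℕ :=
  (∑ j ∈ Finset.range (tableSteps n D R), ∑ s ∈ front D E R j,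
      (2 * (degreeClass E R (s - lastPow n j)).card + 1)) +
    (usedTerms n D R).card * (2 * (Finset.univ.sup fun i : Fin (n + 1) =>
      (degreeClass E R (Finsupp.single i 1)).card) + 1)

theorem computes_tableOutput :
    Computes.{u} (tableCost D E R) fun K _ (x : TableCell E → K) => tableOutput D E R x := by
  classical
  have h := Computes.of_coords_le.{u}
    (f := fun K _ (x : TableCell E ⊕ (Fin (n + 1) →₀ ℕ) → K) => tableFinish D E R x) Finset.univ
    (2 * (Finset.univ.sup fun i : Fin (n + 1) =>
      (degreeClass E R (Finsupp.single i 1)).card) + 1) (fun _ => none)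
    (fun q _ => by
      by_cases hq : ∃ z, IsOuter E (q : Fin (n + 1) →₀ ℕ) z
      · simp only [tableFinish, hq, dite_true]
        refine (computes_reducedTerm E R _ _).mono ?_
        have := Finset.le_sup (f := fun i : Fin (n + 1) =>
          (degreeClass E R (Finsupp.single i 1)).card) (Finset.mem_univ hq.choose.1)
        omega
      · simp only [tableFinish, hq, dite_false]
        exact (ComputesScalar.cell _).mono (Nat.zero_le _))
    (fun q hq => absurd (Finset.mem_univ q) hq)
  have h2 := h.comp (computes_tableState.{u} D E R (tableSteps n D R)).keep
  rw [Finset.card_univ, Fintype.card_coe] at h2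
  exact h2

end TableProgram

/-! ### Correctness and cost of the computation of the table -/

namespace ShapeSetting

variable {n D : ℕ} {E : Finset (Fin (n + 1) →₀ ℕ)}
  {R : (Fin (n + 1) →₀ ℕ) → (Fin (n + 1) →₀ ℕ) → Prop} {K : Type*} [Field K]
  {G : Subgroup (GL (Fin (n + 1)) K)} {I : Ideal (MvPolynomial (Fin (n + 1)) K)}
  {𝒢 : Set (MvPolynomial (Fin (n + 1)) K)} {c : Fin (n + 1) → Fin D → K}

theorem card_degreeClass_le (S : ShapeSetting E R G I 𝒢 c) (t : Fin (n + 1) →₀ ℕ) :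
    (degreeClass E R t).card ≤ zeroCount n D R := by
  classical
  exact S.card_class_le t

/-- Each round computes at most one term for each nontrivial column, and homogeneity limits each
reduction to a single degree class. -/
theorem tableCost_le (S : ShapeSetting E R G I 𝒢 c) :
    tableCost D E R ≤ tableSteps n D R * ((nontrivialColumns E).card * (2 * zeroCount n D R + 1))
      + (usedTerms n D R).card * (2 * zeroCount n D R + 1) := by
  classical
  refine add_le_add ?_ (Nat.mul_le_mul_left _ ?_)
  · rw [← Finset.card_range (tableSteps n D R), ← smul_eq_mul, Finset.card_range]
    refine (Finset.sum_le_card_nsmul _ _ _ fun j _ => ?_).trans (by rw [Finset.card_range])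
    refine (Finset.sum_le_card_nsmul _ _ (2 * zeroCount n D R + 1) fun s _ => ?_).trans ?_
    · have := S.card_degreeClass_le (s - lastPow n j); omega
    · exact Nat.mul_le_mul_right _ ((Finset.card_filter_le _ _).trans Finset.card_image_le)
  · have : (Finset.univ.sup fun i : Fin (n + 1) =>
        (degreeClass E R (Finsupp.single i 1)).card) ≤ zeroCount n D R :=
      Finset.sup_le fun i _ => S.card_degreeClass_le _
    omega

variable {r : E → K} {u : (Fin (n + 1) →₀ ℕ) → K}

/-- The basis element is homogeneous and its tail lies in the staircase, so the sum runs over one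
degree class of `E` instead of all of `E`. -/
theorem table_reduce (S : ShapeSetting E R G I 𝒢 c) (hu : IsTableOf 𝒢 E r u)
    {l : Fin (n + 1) →₀ ℕ} (hl : l ∈ leadingMonomials (drl (n + 1)) 𝒢) (a : ℕ) :
    u (l + lastPow n a) = - ∑ s ∈ degreeClass E R l,
      basisCoeff (drl (n + 1)) 𝒢 l s * u (s + lastPow n a) := by
  classical
  have hl' : ∃ g ∈ 𝒢, (drl (n + 1)).degree g = l := hl
  obtain ⟨g, hg, hgl, hc⟩ : ∃ g ∈ 𝒢, (drl (n + 1)).degree g = l ∧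
      ∀ s, basisCoeff (drl (n + 1)) 𝒢 l s = g.coeff s :=
    ⟨hl'.choose, hl'.choose_spec.1, hl'.choose_spec.2, fun s => by rw [basisCoeff, dif_pos hl']⟩
  have hgI := S.drl_basis.1 g hg
  have hlc : g.coeff l = 1 := by rw [← hgl]; exact hgI.2.coeff_degree
  have h1 := hu.2 g hg (lastPow n a)
  rw [tableBracket_mul_monomial, ← Finset.add_sum_erase _ _
    (MvPolynomial.mem_support_iff.2 (by rw [hlc]; exact one_ne_zero) : l ∈ g.support), hlc,
    one_mul] at h1
  rw [eq_neg_of_add_eq_zero_left h1]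
  congr 1
  simp only [hc]
  have hE : ∀ s ∈ g.support, s ≠ l → s ∈ staircase (drl (n + 1)) 𝒢 := fun s hs hne =>
    S.drl_basis.mem_staircase_of_ne_degree hg hs (by rw [hgl]; exact hne)
  refine Finset.sum_subset (fun s hs => ?_) fun s hs hs' => ?_
  · obtain ⟨hne, hs⟩ := Finset.mem_erase.1 hs
    refine Finset.mem_filter.2 ⟨?_, (S.rel_iff _ _).1 (S.drl_basis.sameGDegree S.diag S.invariant
      hgI.1 hE (MvPolynomial.mem_support_iff.1 hs))⟩
    have := hE s hs hne
    rwa [S.staircase_eq] at this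
  · have hne : s ≠ l := by
      rintro rfl
      have h2 : s ∈ staircase (drl (n + 1)) 𝒢 := by
        rw [S.staircase_eq]; exact (Finset.mem_filter.1 hs).1
      exact h2 g hg hgl.le
    rw [MvPolynomial.notMem_support_iff.1 fun h => hs' (Finset.mem_erase.2 ⟨hne, h⟩), zero_mul]

theorem reducedTerm_eq (S : ShapeSetting E R G I 𝒢 c) (hu : IsTableOf 𝒢 E r u)
    {st : (Fin (n + 1) →₀ ℕ) → K} {l : Fin (n + 1) →₀ ℕ}
    (hl : l ∈ leadingMonomials (drl (n + 1)) 𝒢) (a : ℕ)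
    (hst : ∀ s ∈ E, R s l → st (s + lastPow n a) = u (s + lastPow n a)) :
    reducedTerm E R (Sum.elim (tableInput 𝒢 E r) st) l a = u (l + lastPow n a) := by
  classical
  rw [S.table_reduce hu hl, reducedTerm]
  congr 1
  refine Finset.sum_congr rfl fun s hs => ?_
  have hs' := Finset.mem_filter.1 hs
  rw [Sum.elim_inl, Sum.elim_inr, hst s hs'.1 hs'.2]
  rfl

/-- A reduction stays within the degree of the reduced monomial, so the terms of the single degree
of the Hankel entries can be computed without those of the others. -/
theorem tableState_eq (S : ShapeSetting E R G I 𝒢 c) (hu : IsTableOf 𝒢 E r u) (j : ℕ) :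
    ∀ s ∈ E, ∀ a ≤ j, R (s + lastPow n a) (lastPow n (baseExponent n D R)) →
      tableState D E R (tableInput 𝒢 E r) j (s + lastPow n a) = u (s + lastPow n a) := by
  classical
  induction j with
  | zero =>
    intro s hs a ha _
    obtain rfl : a = 0 := Nat.le_zero.1 ha
    rw [lastPow_zero, add_zero]
    exact (dif_pos hs).trans (hu.1 ⟨s, hs⟩).symm
  | succ j ih =>
    have hfront : ∀ q ∈ front D E R j, reducedTerm E R (Sum.elim (tableInput 𝒢 E r)
        (tableState D E R (tableInput 𝒢 E r) j)) (q - lastPow n j) j = u q := by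
      intro q hq
      obtain ⟨hq1, hqR⟩ := Finset.mem_filter.1 hq
      obtain ⟨m, hm, rfl⟩ := Finset.mem_image.1 hq1
      obtain ⟨hmE, hmx⟩ := Finset.mem_filter.1 hm
      have e1 : m + lastPow n (j + 1) = m + lastPow n 1 + lastPow n j := by
        rw [add_assoc, ← lastPow_add, add_comm 1 j]
      rw [e1] at hqR
      rw [e1, add_tsub_cancel_right]
      -- Property M: a nontrivial column starts at a leading monomial, so that one basis element
      -- suffices for the reduction.
      have hl : m + lastPow n 1 ∈ leadingMonomials (drl (n + 1)) 𝒢 := by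
        rcases S.propertyM m (by rw [S.staircase_eq]; exact hmE) with h | h
        · rw [S.staircase_eq] at h
          exact absurd h hmx
        · exact h
      exact S.reducedTerm_eq hu hl j fun s hs hsR => ih s hs j le_rfl
        (S.rel_trans (S.rel_add hsR (S.rel_refl _)) hqR)
    intro s hs a ha hR
    rw [tableState, tableStep]
    -- A term already known may occur in the front again; recomputing it gives the same value.
    by_cases hq : s + lastPow n a ∈ front D E R j
    · rw [if_pos hq, hfront _ hq]
    · rw [if_neg hq, Sum.elim_inr]
      rcases Nat.le_succ_iff.1 ha with h | rfl
      · exact ih s hs a h hR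
      · have hsx : s + lastPow n 1 ∈ E := by
          by_contra hsx
          exact hq (Finset.mem_filter.2 ⟨Finset.mem_image.2 ⟨s, Finset.mem_filter.2 ⟨hs, hsx⟩, rfl⟩,
            hR⟩)
        have e1 : s + lastPow n (j + 1) = s + lastPow n 1 + lastPow n j := by
          rw [add_assoc, ← lastPow_add, add_comm 1 j]
        rw [e1] at hR ⊢
        exact ih _ hsx j le_rfl hR

theorem rel_add_period (S : ShapeSetting E R G I 𝒢 c) (s : Fin (n + 1) →₀ ℕ) (a j : ℕ) :
    R (s + lastPow n (a + lastPeriod n R * j)) (s + lastPow n a) := by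
  have := S.rel_add (S.rel_refl (s + lastPow n a)) (S.rel_mul_period j)
  rwa [add_zero, add_assoc, ← lastPow_add] at this

theorem rel_seq (S : ShapeSetting E R G I 𝒢 c) (j : ℕ) :
    R (lastPow n (seqExponent n D R j)) (lastPow n (baseExponent n D R)) := by
  have := S.rel_add_period 0 (baseExponent n D R) j
  rwa [zero_add, zero_add] at this

/-- The number of rounds comes from here: the largest exponent of the sequence is b + d(2N - 1) = D
- 1 + dN, and those multiplying another variable are below dN. -/
theorem usedTerms_spec (S : ShapeSetting E R G I 𝒢 c) {q : Fin (n + 1) →₀ ℕ}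
    (hq : q ∈ usedTerms n D R) :
    R q (lastPow n (baseExponent n D R)) ∧ ∃ a ≤ tableSteps n D R,
      q = lastPow n a ∨ ∃ i ≠ Fin.last n, q = Finsupp.single i 1 + lastPow n a := by
  classical
  have hD := S.degree_pos
  have hN : 0 < zeroCount n D R := Nat.succ_pos _
  have hb := baseExponent_add n D R
  have hmul : ∀ i j, i ≤ j → lastPeriod n R * i ≤ lastPeriod n R * j := fun i j h =>
    Nat.mul_le_mul_left _ h
  have hseq : ∀ j < 2 * zeroCount n D R, seqExponent n D R j ≤ tableSteps n D R := by
    intro j hj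
    have h1 := hmul j ((zeroCount n D R - 1) + zeroCount n D R) (by omega)
    rw [mul_add] at h1
    rw [seqExponent, tableSteps]; omega
  rcases Finset.mem_union.1 hq with h | h
  · obtain ⟨j, hj, rfl⟩ := Finset.mem_image.1 h
    exact ⟨S.rel_seq j, _, hseq j (Finset.mem_range.1 hj), Or.inl rfl⟩
  · obtain ⟨⟨i, j⟩, hj, rfl⟩ := Finset.mem_image.1 h
    have hj' : j < zeroCount n D R := by simpa using hj
    have hi : i.castSucc ≠ Fin.last n := (Fin.castSucc_lt_last i).ne
    dsimp only
    rw [rhsIndex, if_neg hi]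
    by_cases hs : HasShift n D R i.castSucc
    · rw [if_pos hs, shapeLead_of_ne hi]
      have ht : shiftExponent n D R i.castSucc = hs.choose := by
        rw [shiftExponent, if_neg hi, dif_pos hs]
      have hspec := hs.choose_spec
      rw [← ht, shapeLead_of_ne hi] at hspec
      refine ⟨S.rel_trans (S.rel_add_period _ _ _) hspec.2, _, ?_, Or.inr ⟨_, hi, rfl⟩⟩
      have h1 := hmul (j + 1) (zeroCount n D R) hj'
      rw [mul_add, mul_one] at h1
      rw [tableSteps]; omega
    · rw [if_neg hs]
      exact ⟨S.rel_seq 0, _, hseq 0 (by omega), Or.inl rfl⟩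

/-- A variable in the staircase times a power of the last one is covered by the rounds; a variable
outside of it is itself a leading monomial, and one further reduction reaches known terms. -/
theorem tableOutput_eq (S : ShapeSetting E R G I 𝒢 c) (hu : IsTableOf 𝒢 E r u)
    (q : usedTerms n D R) : tableOutput D E R (tableInput 𝒢 E r) q = u q := by
  classical
  obtain ⟨hR, a, ha, h⟩ := S.usedTerms_spec q.2
  have hst := S.tableState_eq hu (tableSteps n D R)
  rw [tableOutput, tableFinish]
  by_cases hq : ∃ z, IsOuter E (q : Fin (n + 1) →₀ ℕ) z
  · rw [dif_pos hq]
    obtain ⟨h1, h2, h3⟩ := hq.choose_spec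
    generalize hq.choose = z at h1 h2 h3 ⊢
    have hlast : (q : Fin (n + 1) →₀ ℕ) (Fin.last n) = z.2 := by
      rw [h3, Finsupp.add_apply, lastPow_last, Finsupp.single_apply, if_neg h1, zero_add]
    have hqa : (q : Fin (n + 1) →₀ ℕ) (Fin.last n) = a := by
      rcases h with h | ⟨i, hi, h⟩
      · rw [h, lastPow_last]
      · rw [h, Finsupp.add_apply, lastPow_last, Finsupp.single_apply, if_neg hi, zero_add]
    have hle : z.2 ≤ tableSteps n D R := by rw [← hlast, hqa]; exact ha
    have hR' := hR
    rw [h3] at hR'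
    rw [S.reducedTerm_eq hu (S.drl_basis.single_mem S.zeroDim.1 _ (by rwa [S.staircase_eq])) _
      fun s hs hsR => hst s hs _ hle (S.rel_trans (S.rel_add hsR (S.rel_refl _)) hR')]
    rw [← h3]
  · rw [dif_neg hq, Sum.elim_inr]
    rcases h with h | ⟨i, hi, h⟩
    · have := hst 0 S.zero_mem a ha
      rw [zero_add, ← h] at this
      exact this hR
    · have hiE : Finsupp.single i 1 ∈ E := by
        by_contra hiE
        exact hq ⟨(i, a), hi, hiE, h⟩
      have := hst _ hiE a ha
      rw [← h] at this
      exact this hR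

end ShapeSetting

/-! ### The recovery of the basis -/

section GuessProgram

variable (n D : ℕ) (R : (Fin (n + 1) →₀ ℕ) → (Fin (n + 1) →₀ ℕ) → Prop)

/-- The index of the table term that is an entry of the Hankel matrix or of a right-hand side. -/
def guessIndex : ℕ ⊕ Fin (n + 1) × ℕ → Fin (n + 1) →₀ ℕ
  | Sum.inl j => lastPow n (seqExponent n D R j)
  | Sum.inr z => rhsIndex n D R z.1 z.2

/-- The input of the Hankel solver. -/
def guessInput {K : Type*} [Field K] (x : usedTerms n D R → K) (z : ℕ ⊕ Fin (n + 1) × ℕ) : K :=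
  if h : guessIndex n D R z ∈ usedTerms n D R then x ⟨_, h⟩ else 0

/-- The place of a coefficient of the basis among the solutions of the Hankel systems. -/
def guessPlace (z : Fin (n + 1) × Fin D) : Option (Fin (n + 1) × ℕ) :=
  open Classical in
  if (z.1 = Fin.last n ∨ HasShift n D R z.1) ∧
      baseExponent n D R ≤ z.2 + shiftExponent n D R z.1 ∧
      lastPeriod n R ∣ z.2 + shiftExponent n D R z.1 - baseExponent n D R then
    some (z.1, (z.2 + shiftExponent n D R z.1 - baseExponent n D R) / lastPeriod n R)
  else none

/-- The coefficients of the basis, from the table terms. -/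
def guessOutput {K : Type*} [Field K] (x : usedTerms n D R → K) (z : Fin (n + 1) × Fin D) : K :=
  (guessPlace n D R z).elim 0 (hankelSolveAll (zeroCount n D R) (guessInput n D R x))

theorem computes_guessOutput :
    Computes.{u} (60 * (n + 1) * zeroCount n D R ^ 2)
      fun K _ (x : usedTerms n D R → K) => guessOutput n D R x := by
  have h1 : Computes.{u} 0 fun K _ (x : usedTerms n D R → K) => guessInput n D R x :=
    (Computes.select.{u} fun z => if h : guessIndex n D R z ∈ usedTerms n D R then some ⟨_, h⟩
      else none).congr fun K _ x z => by
        by_cases h : guessIndex n D R z ∈ usedTerms n D R <;> simp [guessInput, h]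
  have h2 := (Computes.select.{u} (guessPlace n D R)).comp
    ((computes_hankelSolveAll.{u} (Fin (n + 1)) (zeroCount n D R) (Nat.succ_pos _)).comp h1)
  rw [Fintype.card_fin, zero_add, add_zero] at h2
  exact h2

end GuessProgram

/-! ### Correctness of the recovery of the basis -/

namespace ShapeSetting

variable {n D : ℕ} {E : Finset (Fin (n + 1) →₀ ℕ)}
  {R : (Fin (n + 1) →₀ ℕ) → (Fin (n + 1) →₀ ℕ) → Prop} {K : Type*} [Field K]
  {G : Subgroup (GL (Fin (n + 1)) K)} {I : Ideal (MvPolynomial (Fin (n + 1)) K)}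
  {𝒢 : Set (MvPolynomial (Fin (n + 1)) K)} {c : Fin (n + 1) → Fin D → K}

theorem shapePolynomial_mem (S : ShapeSetting E R G I 𝒢 c) (i : Fin (n + 1)) :
    shapePolynomial D i (c i) ∈ I :=
  (S.lex_basis.1 _ ⟨i, rfl⟩).1

theorem shape_relation (S : ShapeSetting E R G I 𝒢 c)
    (φ : (MvPolynomial (Fin (n + 1)) K ⧸ I) →ₗ[K] K) (i : Fin (n + 1)) (a : ℕ) :
    quotientTable φ (shapeLead n D i + lastPow n a)
      + ∑ j : Fin D, c i j * quotientTable φ (lastPow n (j + a)) = 0 := by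
  have h := I.mul_mem_right (MvPolynomial.monomial (lastPow n a) 1) (S.shapePolynomial_mem i)
  have h2 := congrArg φ (Ideal.Quotient.eq_zero_iff_mem.2 h)
  rw [map_zero, shapePolynomial_eq, add_mul, shapeTail, Finset.sum_mul, map_add, map_add, map_sum,
    map_sum, MvPolynomial.monomial_mul, one_mul] at h2
  rw [← h2, quotientTable]
  congr 1
  refine Finset.sum_congr rfl fun j _ => ?_
  rw [MvPolynomial.monomial_mul, mul_one, ← lastPow_add, quotientTable, ← smul_eq_mul, ← map_smul,
    ← Ideal.Quotient.mkₐ_eq_mk K, ← map_smul, MvPolynomial.smul_monomial, smul_eq_mul, mul_one]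

theorem rel_of_coeff_ne_zero (S : ShapeSetting E R G I 𝒢 c) {i : Fin (n + 1)} {j : Fin D}
    (hc : c i j ≠ 0) : R (lastPow n j) (shapeLead n D i) := by
  refine (S.rel_iff _ _).1 (S.lex_basis.sameGDegree S.diag S.invariant (S.shapePolynomial_mem i)
    (fun s hs hne => ?_) ?_)
  · rw [MvPolynomial.mem_support_iff, shapePolynomial_eq, MvPolynomial.coeff_add,
      MvPolynomial.coeff_monomial, if_neg (Ne.symm hne), zero_add] at hs
    obtain ⟨l, hl, rfl⟩ := exists_of_coeff_shapeTail hs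
    rw [staircase_shapeBasis]
    exact ⟨l, hl, rfl⟩
  · have hne : shapeLead n D i ≠ lastPow n j := fun h =>
      absurd (lastPow_lt_shapeLead i j.2) (by rw [h]; exact lt_irrefl _)
    rw [shapePolynomial_eq, MvPolynomial.coeff_add, MvPolynomial.coeff_monomial, if_neg hne,
      zero_add, coeff_shapeTail_lastPow]
    exact hc

/-- The leading monomial of index `i` can be moved to the degree of the Hankel matrix. -/
theorem shift_spec (S : ShapeSetting E R G I 𝒢 c) {i : Fin (n + 1)}
    (hi : i = Fin.last n ∨ HasShift n D R i) :
    shiftExponent n D R i < lastPeriod n R ∧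
      R (shapeLead n D i + lastPow n (shiftExponent n D R i)) (lastPow n (baseExponent n D R)) ∧
      ∀ j, rhsIndex n D R i j
        = shapeLead n D i + lastPow n (shiftExponent n D R i + lastPeriod n R * j) := by
  have hd := S.period_spec.1
  by_cases hl : i = Fin.last n
  · subst hl
    have hD := S.degree_pos
    have hN : 0 < zeroCount n D R := Nat.succ_pos _
    have hb := baseExponent_add n D R
    have hmul : lastPeriod n R * (zeroCount n D R - 1) + lastPeriod n R
        = lastPeriod n R * zeroCount n D R := by
      rw [← Nat.mul_succ, Nat.succ_eq_add_one, Nat.sub_add_cancel hN]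
    have ht : shiftExponent n D R (Fin.last n) = lastPeriod n R - 1 := by
      rw [shiftExponent, if_pos rfl]
    -- From D - 1 = b + d(N - 1): the shift by d - 1 carries the leading exponent D to b + dN, the
    -- first one behind the Hankel columns.
    have hseq : ∀ j, D + (lastPeriod n R - 1 + lastPeriod n R * j)
        = seqExponent n D R (zeroCount n D R + j) := by
      intro j
      rw [seqExponent, mul_add]; omega
    rw [ht, shapeLead_last]
    refine ⟨by omega, ?_, fun j => ?_⟩
    · have := S.rel_seq (zeroCount n D R + 0)
      rwa [← hseq, mul_zero, add_zero, lastPow_add] at this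
    · rw [rhsIndex, if_pos rfl, ← lastPow_add, hseq]
  · have hs := hi.resolve_left hl
    have ht : shiftExponent n D R i = hs.choose := by
      rw [shiftExponent, if_neg hl, dif_pos hs]
    have hspec := hs.choose_spec
    rw [← ht] at hspec
    refine ⟨hspec.1, hspec.2, fun j => ?_⟩
    rw [rhsIndex, if_neg hl, if_pos hs]

/-- The exponents of the monomials of the polynomial of index `i`. -/
theorem exists_of_coeff_ne_zero (S : ShapeSetting E R G I 𝒢 c) {i : Fin (n + 1)} {j : Fin D}
    (hc : c i j ≠ 0) : (i = Fin.last n ∨ HasShift n D R i) ∧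
      ∃ k < zeroCount n D R,
        j + shiftExponent n D R i = baseExponent n D R + lastPeriod n R * k := by
  have hd := S.period_spec.1
  have hR := S.rel_of_coeff_ne_zero hc
  have hgood : i = Fin.last n ∨ HasShift n D R i := by
    -- The witness is b - j modulo d, written without subtraction as b + j(d - 1).
    refine Or.inr ⟨(baseExponent n D R + j * (lastPeriod n R - 1)) % lastPeriod n R,
      Nat.mod_lt _ hd, ?_⟩
    refine S.rel_trans (S.rel_add (S.rel_symm hR) (S.rel_refl _)) ?_
    rw [← lastPow_add, S.rel_lastPow_iff]
    have h1 : (j : ℕ) + (baseExponent n D R + j * (lastPeriod n R - 1))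
        = baseExponent n D R + lastPeriod n R * j := by
      obtain ⟨d', hd'⟩ : ∃ d', lastPeriod n R = d' + 1 := ⟨lastPeriod n R - 1, by omega⟩
      rw [hd', Nat.add_sub_cancel]; ring
    calc (j : ℕ) + (baseExponent n D R + j * (lastPeriod n R - 1)) % lastPeriod n R
        ≡ j + (baseExponent n D R + j * (lastPeriod n R - 1)) [MOD lastPeriod n R] :=
          (Nat.mod_modEq _ _).add_left _
      _ ≡ baseExponent n D R [MOD lastPeriod n R] := by
          rw [h1, Nat.ModEq, Nat.add_mul_mod_self_left]
  refine ⟨hgood, ?_⟩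
  obtain ⟨hlt, hR', -⟩ := S.shift_spec hgood
  have h2 := S.rel_trans (S.rel_add hR (S.rel_refl (lastPow n (shiftExponent n D R i)))) hR'
  rw [← lastPow_add, S.rel_lastPow_iff] at h2
  have hbase : baseExponent n D R < lastPeriod n R := Nat.mod_lt _ hd
  have h3 : (j + shiftExponent n D R i) % lastPeriod n R = baseExponent n D R :=
    Eq.trans h2 (Nat.mod_eq_of_lt hbase)
  have h4 := Nat.mod_add_div (j + shiftExponent n D R i) (lastPeriod n R)
  rw [h3] at h4
  refine ⟨_, ?_, h4.symm⟩
  -- From j ≤ D - 1 and a shift of at most d - 1, the shifted exponent is below D - 1 + d = b + dN.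
  by_contra hk
  have h5 := Nat.mul_le_mul_left (lastPeriod n R) (not_lt.1 hk)
  have hb := baseExponent_add n D R
  have hN : 0 < zeroCount n D R := Nat.succ_pos _
  have hmul : lastPeriod n R * (zeroCount n D R - 1) + lastPeriod n R
      = lastPeriod n R * zeroCount n D R := by
    rw [← Nat.mul_succ, Nat.succ_eq_add_one, Nat.sub_add_cancel hN]
  have := j.2
  omega

/-- The coefficients of the polynomial of index `i`, as a solution of a Hankel system. -/
def hankelCoeff (n D : ℕ) (R : (Fin (n + 1) →₀ ℕ) → (Fin (n + 1) →₀ ℕ) → Prop) {K : Type*} [Field K]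
    (c : Fin (n + 1) → Fin D → K) (i : Fin (n + 1)) (k : ℕ) : K :=
  if h : shiftExponent n D R i ≤ seqExponent n D R k ∧
      seqExponent n D R k - shiftExponent n D R i < D then
    c i ⟨seqExponent n D R k - shiftExponent n D R i, h.2⟩
  else 0

theorem hankelCoeff_eq {i : Fin (n + 1)} {j : Fin D} {k : ℕ}
    (h : j + shiftExponent n D R i = seqExponent n D R k) : hankelCoeff n D R c i k = c i j := by
  have h1 : seqExponent n D R k - shiftExponent n D R i = j := by omega
  rw [hankelCoeff, dif_pos ⟨by omega, by rw [h1]; exact j.2⟩]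
  congr 1
  exact Fin.ext h1

/-- Multiply the shape polynomial by the shift and by x^(dl), x the last variable. By homogeneity
only the exponents j with j + shift = b + dk have nonzero coefficients, so the sum over j < D
becomes one over k < N. -/
theorem hankel_relation (S : ShapeSetting E R G I 𝒢 c)
    (φ : (MvPolynomial (Fin (n + 1)) K ⧸ I) →ₗ[K] K) {i : Fin (n + 1)}
    (hi : i = Fin.last n ∨ HasShift n D R i) (l : ℕ) :
    quotientTable φ (rhsIndex n D R i l) + ∑ k ∈ Finset.range (zeroCount n D R),
      quotientTable φ (lastPow n (seqExponent n D R (l + k))) * hankelCoeff n D R c i k = 0 := by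
  have hd := S.period_spec.1
  obtain ⟨hlt, -, hidx⟩ := S.shift_spec hi
  have h := S.shape_relation φ i (shiftExponent n D R i + lastPeriod n R * l)
  rw [hidx, ← h]
  congr 1
  have hval : ∀ (j : Fin D) (k : ℕ), j + shiftExponent n D R i = seqExponent n D R k →
      quotientTable φ (lastPow n (seqExponent n D R (l + k))) * hankelCoeff n D R c i k
      = c i j * quotientTable φ (lastPow n (j + (shiftExponent n D R i + lastPeriod n R * l))) := by
    intro j k hjk
    rw [hankelCoeff_eq hjk, mul_comm]
    congr 3
    rw [seqExponent] at hjk ⊢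
    rw [mul_add]; omega
  symm
  -- Only nonzero terms are matched: a column k may correspond to no exponent in the range 0, ..., D
  -- - 1, where `hankelCoeff` is 0.
  refine Finset.sum_bij_ne_zero
    (fun j _ hj => (S.exists_of_coeff_ne_zero (left_ne_zero_of_mul hj)).2.choose)
    (fun j _ hj => Finset.mem_range.2
      (S.exists_of_coeff_ne_zero (left_ne_zero_of_mul hj)).2.choose_spec.1)
    (fun j _ hj j' _ hj' hjj => ?_) (fun k _ hk => ?_) (fun j _ hj => ?_)
  · have h1 := (S.exists_of_coeff_ne_zero (left_ne_zero_of_mul hj)).2.choose_spec.2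
    have h2 := (S.exists_of_coeff_ne_zero (left_ne_zero_of_mul hj')).2.choose_spec.2
    rw [hjj, ← h2] at h1
    exact Fin.ext (Nat.add_right_cancel h1)
  · have hk' := right_ne_zero_of_mul hk
    have hcond : shiftExponent n D R i ≤ seqExponent n D R k ∧
        seqExponent n D R k - shiftExponent n D R i < D := by
      by_contra hcond
      exact hk' (dif_neg hcond)
    have hjk : ((⟨_, hcond.2⟩ : Fin D) : ℕ) + shiftExponent n D R i = seqExponent n D R k :=
      Nat.sub_add_cancel hcond.1
    have hne := hk
    rw [hval _ k hjk] at hne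
    refine ⟨⟨_, hcond.2⟩, Finset.mem_univ _, hne, ?_⟩
    have h2 := (S.exists_of_coeff_ne_zero (left_ne_zero_of_mul hne)).2.choose_spec.2
    exact (Nat.eq_of_mul_eq_mul_left hd (Nat.add_left_cancel (hjk.symm.trans h2))).symm
  · exact (hval j _ (S.exists_of_coeff_ne_zero (left_ne_zero_of_mul hj)).2.choose_spec.2).symm

/-- The second part of the algorithm recovers the basis, if the Hankel matrix is nonsingular. -/
theorem guessOutput_eq (S : ShapeSetting E R G I 𝒢 c)
    (φ : (MvPolynomial (Fin (n + 1)) K ⧸ I) →ₗ[K] K)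
    (hw : HankelNonsingular (fun j => quotientTable φ (lastPow n (seqExponent n D R j)))
      (zeroCount n D R)) (i : Fin (n + 1)) (j : Fin D) :
    guessOutput n D R (fun q : usedTerms n D R => quotientTable φ q) (i, j) = c i j := by
  have hd := S.period_spec.1
  by_cases hcond : (i = Fin.last n ∨ HasShift n D R i) ∧
      baseExponent n D R ≤ j + shiftExponent n D R i ∧
      lastPeriod n R ∣ j + shiftExponent n D R i - baseExponent n D R
  swap
  -- Where the algorithm returns 0 without solving a system, the coefficient vanishes by
  -- homogeneity.
  · rw [guessOutput, guessPlace, if_neg hcond]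
    by_contra hc
    obtain ⟨hi, k, -, hk⟩ := S.exists_of_coeff_ne_zero (i := i) (j := j) fun h => hc h.symm
    exact hcond ⟨hi, by omega, by rw [hk, Nat.add_sub_cancel_left]; exact dvd_mul_right _ _⟩
  obtain ⟨hi, hle, k, hk⟩ := hcond
  have hjk : j + shiftExponent n D R i = seqExponent n D R k := by rw [seqExponent]; omega
  have hkN : k < zeroCount n D R := by
    by_contra hkN
    have h5 := Nat.mul_le_mul_left (lastPeriod n R) (not_lt.1 hkN)
    have hb := baseExponent_add n D R
    have hN : 0 < zeroCount n D R := Nat.succ_pos _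
    have hmul : lastPeriod n R * (zeroCount n D R - 1) + lastPeriod n R
        = lastPeriod n R * zeroCount n D R := by
      rw [← Nat.mul_succ, Nat.succ_eq_add_one, Nat.sub_add_cancel hN]
    have := j.2
    have := (S.shift_spec hi).1
    omega
  have hplace : guessPlace n D R (i, j) = some (i, k) := by
    rw [guessPlace, if_pos ⟨hi, hle, k, hk⟩, hk, Nat.mul_div_cancel_left _ hd]
  rw [guessOutput, hplace, Option.elim_some, hankelSolveAll, if_pos hkN]
  have hseq : ∀ m < 2 * zeroCount n D R,
      guessInput n D R (fun q : usedTerms n D R => quotientTable φ q) (Sum.inl m)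
        = quotientTable φ (lastPow n (seqExponent n D R m)) := fun m hm =>
    dif_pos (seq_mem_usedTerms n D R hm)
  have hrhs : ∀ l < zeroCount n D R,
      guessInput n D R (fun q : usedTerms n D R => quotientTable φ q) (Sum.inr (i, l))
        = quotientTable φ (rhsIndex n D R i l) := fun l hl =>
    dif_pos (rhs_mem_usedTerms n D R i hl)
  rw [← HankelNonsingular.eq_hankelSolve (γ := hankelCoeff n D R c i) ?_ ?_ k hkN]
  · exact hankelCoeff_eq hjk
  -- The entries given to the solver agree with the table only for indices below 2N, which covers
  -- all l + k with l, k < N.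
  · intro p hp
    refine hw p fun l hl => ?_
    rw [← hp l hl]
    refine Finset.sum_congr rfl fun k hk => ?_
    have := Finset.mem_range.1 hk
    exact congrArg (· * p k) (hseq (l + k) (by omega)).symm
  · intro l hl
    rw [hrhs l hl, ← S.hankel_relation φ hi l]
    congr 1
    refine Finset.sum_congr rfl fun k hk => ?_
    have := Finset.mem_range.1 hk
    rw [hseq _ (by omega)]

end ShapeSetting

/-! ### Genericity -/

section Generic

variable {K : Type*} [Field K]

theorem hankelNonsingular_iff_det (w : ℕ → K) (N : ℕ) : HankelNonsingular w N ↔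
    (Matrix.of fun i j : Fin N => w (i + j)).det ≠ 0 := by
  have hmv : ∀ (p : ℕ → K) (l : Fin N), (Matrix.of fun i j : Fin N => w (i + j)).mulVec
      (fun k : Fin N => p k) l = ∑ k ∈ Finset.range N, w (l + k) * p k := fun p l => by
    rw [Finset.sum_range]; rfl
  constructor
  · intro h h0
    obtain ⟨v, hv, hv0⟩ := Matrix.exists_mulVec_eq_zero_iff.2 h0
    apply hv
    let p : ℕ → K := fun k => if hk : k < N then v ⟨k, hk⟩ else 0
    have hp : v = fun k : Fin N => p k := by
      funext k
      simp [p]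
    have := h p fun l hl => by rw [← hmv p ⟨l, hl⟩, ← hp, hv0]; rfl
    rw [hp]
    exact funext fun k => this k k.2
  · intro h p hp k hk
    have h1 : (Matrix.of fun i j : Fin N => w (i + j)).mulVec (fun k : Fin N => p k) = 0 :=
      funext fun l => by rw [hmv]; exact hp l l.2
    exact congrFun (Matrix.eq_zero_of_mulVec_eq_zero h h1) ⟨k, hk⟩

/-- Back substitution: row `q` determines the entry `N - 1 - q`, as the later entries are already
zero. The terms `w m` with `m ≥ N` are arbitrary. -/
theorem hankelNonsingular_of_antitriangular {w : ℕ → K} {N : ℕ}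
    (hw : ∀ m < N, w m = if m = N - 1 then 1 else 0) : HankelNonsingular w N := by
  intro p hp
  have key : ∀ q < N, p (N - 1 - q) = 0 := by
    intro q
    induction q using Nat.strong_induction_on with
    | _ q ih =>
      intro hq
      have h := hp q hq
      rw [Finset.sum_eq_single (N - 1 - q)] at h
      · rwa [hw _ (by omega), if_pos (by omega), one_mul] at h
      · intro k hk hne
        have hk' := Finset.mem_range.1 hk
        rcases lt_or_gt_of_ne hne with hlt | hgt
        · rw [hw _ (by omega), if_neg (by omega), zero_mul]
        · have := ih (N - 1 - k) (by omega) (by omega)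
          rw [show N - 1 - (N - 1 - k) = k by omega] at this
          rw [this, mul_zero]
      · intro hk
        exact absurd (Finset.mem_range.2 (by omega)) hk
  intro k hk
  have := key (N - 1 - k) (by omega)
  rwa [show N - 1 - (N - 1 - k) = k by omega] at this

theorem totalDegree_det_le {σ : Type*} {N : ℕ} (M : Matrix (Fin N) (Fin N) (MvPolynomial σ K))
    (h : ∀ i j, (M i j).totalDegree ≤ 1) : M.det.totalDegree ≤ N := by
  rw [Matrix.det_apply']
  refine MvPolynomial.totalDegree_finsetSum_le fun τ _ => ?_
  refine (MvPolynomial.totalDegree_mul _ _).trans ?_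
  have h1 : ((Equiv.Perm.sign τ : ℤ) : MvPolynomial σ K).totalDegree = 0 := by
    rw [← map_intCast (MvPolynomial.C : K →+* MvPolynomial σ K), MvPolynomial.totalDegree_C]
  rw [h1, zero_add]
  refine (MvPolynomial.totalDegree_finsetProd _ _).trans ?_
  refine (Finset.sum_le_sum fun i _ => h (τ i) i).trans ?_
  simp

end Generic

/-! ### The Hankel determinant as a polynomial in the random vector, and the total cost -/

namespace ShapeSetting

variable {n D : ℕ} {E : Finset (Fin (n + 1) →₀ ℕ)}
  {R : (Fin (n + 1) →₀ ℕ) → (Fin (n + 1) →₀ ℕ) → Prop} {K : Type*} [Field K]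
  {G : Subgroup (GL (Fin (n + 1)) K)} {I : Ideal (MvPolynomial (Fin (n + 1)) K)}
  {𝒢 : Set (MvPolynomial (Fin (n + 1)) K)} {c : Fin (n + 1) → Fin D → K}

/-- The basis of the quotient formed by the `DRL` staircase. -/
def drlBasis (S : ShapeSetting E R G I 𝒢 c) :
    Module.Basis E K (MvPolynomial (Fin (n + 1)) K ⧸ I) :=
  S.drl_basis.basis.reindex (Equiv.subtypeEquivRight fun s => by rw [S.staircase_eq]; rfl)

theorem drlBasis_apply (S : ShapeSetting E R G I 𝒢 c) (s : E) :
    S.drlBasis s = Ideal.Quotient.mk I (MvPolynomial.monomial (s : Fin (n + 1) →₀ ℕ) 1) := by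
  rw [drlBasis, Module.Basis.reindex_apply, S.drl_basis.basis_apply]
  rfl

/-- The linear form with the values `r` on the `DRL` staircase. -/
def tableForm (S : ShapeSetting E R G I 𝒢 c) (r : E → K) :
    (MvPolynomial (Fin (n + 1)) K ⧸ I) →ₗ[K] K :=
  S.drlBasis.constr K r

theorem isTableOf (S : ShapeSetting E R G I 𝒢 c) (r : E → K) :
    IsTableOf 𝒢 E r (quotientTable (S.tableForm r)) := by
  refine ⟨fun e => ?_, fun g hg => isCRelation_quotientTable _ (S.drl_basis.1 g hg).1⟩
  rw [quotientTable, ← S.drlBasis_apply, tableForm, Module.Basis.constr_basis]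

/-- The table term at `s`, as a linear form in the values on the `DRL` staircase. -/
def termForm (S : ShapeSetting E R G I 𝒢 c) (s : Fin (n + 1) →₀ ℕ) : MvPolynomial E K :=
  ∑ e : E, MvPolynomial.C (S.drlBasis.equivFun
    (Ideal.Quotient.mk I (MvPolynomial.monomial s 1)) e) * MvPolynomial.X e

theorem eval_termForm (S : ShapeSetting E R G I 𝒢 c) (s : Fin (n + 1) →₀ ℕ) (r : E → K) :
    MvPolynomial.eval r (S.termForm s) = quotientTable (S.tableForm r) s := by
  rw [termForm, map_sum, quotientTable, tableForm, Module.Basis.constr_apply_fintype]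
  exact Finset.sum_congr rfl fun e _ => by simp

theorem totalDegree_termForm_le (S : ShapeSetting E R G I 𝒢 c) (s : Fin (n + 1) →₀ ℕ) :
    (S.termForm s).totalDegree ≤ 1 := by
  refine MvPolynomial.totalDegree_finsetSum_le fun e _ => ?_
  refine (MvPolynomial.totalDegree_mul _ _).trans ?_
  rw [MvPolynomial.totalDegree_C, MvPolynomial.totalDegree_X]

/-- The determinant of the Hankel matrix of table terms. -/
def hankelDet (S : ShapeSetting E R G I 𝒢 c) : MvPolynomial E K :=
  (Matrix.of fun i j : Fin (zeroCount n D R) =>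
    S.termForm (lastPow n (seqExponent n D R (i + j)))).det

theorem eval_hankelDet_ne_zero_iff (S : ShapeSetting E R G I 𝒢 c) (r : E → K) :
    MvPolynomial.eval r S.hankelDet ≠ 0 ↔ HankelNonsingular
      (fun j => quotientTable (S.tableForm r) (lastPow n (seqExponent n D R j)))
      (zeroCount n D R) := by
  rw [hankelNonsingular_iff_det, hankelDet, RingHom.map_det]
  simp only [← S.eval_termForm]
  rfl

theorem zeroCount_le (S : ShapeSetting E R G I 𝒢 c) : zeroCount n D R ≤ D := by
  have := Nat.div_le_self (D - 1) (lastPeriod n R)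
  have := S.degree_pos
  rw [zeroCount]; omega

theorem totalDegree_hankelDet_le (S : ShapeSetting E R G I 𝒢 c) : S.hankelDet.totalDegree ≤ D :=
  (totalDegree_det_le _ fun _ _ => S.totalDegree_termForm_le _).trans S.zeroCount_le

/-- The coordinate form of x^(D-1) in the LEX basis, x being the last variable, vanishes at the
exponents b + dm with m < N - 1 and is 1 at b + d(N - 1) = D - 1. -/
theorem exists_eval_hankelDet_ne_zero (S : ShapeSetting E R G I 𝒢 c) :
    ∃ r : E → K, MvPolynomial.eval r S.hankelDet ≠ 0 := by
  classical
  have hd := S.period_spec.1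
  have hD := S.degree_pos
  have hb := baseExponent_add n D R
  let ψ : (MvPolynomial (Fin (n + 1)) K ⧸ I) →ₗ[K] K := S.lex_basis.basis.constr K
    fun s => if (s : Fin (n + 1) →₀ ℕ) = lastPow n (D - 1) then 1 else 0
  have hψ : ∀ j < D, quotientTable ψ (lastPow n j) = if j = D - 1 then 1 else 0 := by
    intro j hj
    have hmem : lastPow n j ∈ staircase MonomialOrder.lex (shapeBasis D c) := by
      rw [staircase_shapeBasis]; exact ⟨j, hj, rfl⟩
    have h1 := S.lex_basis.basis_apply ⟨_, hmem⟩
    rw [quotientTable, ← h1, Module.Basis.constr_basis]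
    simp only [(lastPow_injective n).eq_iff]
  -- Every linear form on the quotient is the table form of its values on the DRL staircase.
  refine ⟨fun e => ψ (S.drlBasis e), (S.eval_hankelDet_ne_zero_iff _).2 ?_⟩
  have hform : S.tableForm (fun e => ψ (S.drlBasis e)) = ψ := Module.Basis.constr_self _ _ _
  rw [hform]
  refine hankelNonsingular_of_antitriangular fun m hm => ?_
  have h1 := Nat.mul_le_mul_left (lastPeriod n R) (Nat.le_sub_one_of_lt hm)
  rw [hψ _ (by rw [seqExponent]; omega)]
  by_cases hmN : m = zeroCount n D R - 1
  · rw [if_pos hmN, if_pos (by rw [seqExponent, hmN]; omega)]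
  · have h2 := Nat.mul_lt_mul_of_pos_left (show m < zeroCount n D R - 1 by omega) hd
    rw [if_neg hmN, if_neg (by rw [seqExponent]; omega)]

/-- With N = `zeroCount n D R`, each contribution is brought to a multiple of (n + 1) k N D: the
rounds with 3(1 + a), the final table terms with 6 and the Hankel systems with 60. A last factor `a`
comes from N ≤ aD/|G|. -/
theorem cost_le (S : ShapeSetting E R G I 𝒢 c) {a : ℝ} (ha : 0 ≤ a)
    (hsplit : (zeroCount n D R : ℝ) * (Nat.card G : ℝ) ≤ a * (D : ℝ)) {m : ℕ}
    (hm : m ≤ tableCost D E R + 60 * (n + 1) * zeroCount n D R ^ 2) :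
    (m : ℝ) ≤ ((69 + 3 * a) * a) * (((n : ℝ) + 1) * ((nontrivialColumns E).card : ℝ) * (D : ℝ) ^ 2
      / (Nat.card G : ℝ)) := by
  have hfin := S.finite
  have hg : (0 : ℝ) < Nat.card G := Nat.cast_pos.2 Nat.card_pos
  have h1 := hm.trans (Nat.add_le_add_right (S.tableCost_le.trans (Nat.add_le_add_left
    (Nat.mul_le_mul_right _ (card_usedTerms_le n D R)) _)) _)
  have h1' : (m : ℝ) ≤ ((D : ℝ) + lastPeriod n R * zeroCount n D R)
      * ((nontrivialColumns E).card * (2 * zeroCount n D R + 1))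
      + (2 * zeroCount n D R + n * zeroCount n D R) * (2 * zeroCount n D R + 1)
      + 60 * (n + 1) * zeroCount n D R ^ 2 := by
    rw [tableSteps] at h1
    exact_mod_cast h1
  have hk : (1 : ℝ) ≤ (nontrivialColumns E).card := by
    exact_mod_cast S.card_nontrivialColumns_pos
  have hN : (1 : ℝ) ≤ zeroCount n D R := by
    exact_mod_cast (Nat.succ_pos _ : 0 < zeroCount n D R)
  have hND : (zeroCount n D R : ℝ) ≤ D := by exact_mod_cast S.zeroCount_le
  have hdg : (lastPeriod n R : ℝ) ≤ Nat.card G := by exact_mod_cast S.period_spec.2.2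
  have hn : (0 : ℝ) ≤ n := Nat.cast_nonneg n
  generalize (lastPeriod n R : ℝ) = d at *
  generalize (zeroCount n D R : ℝ) = N at *
  generalize ((nontrivialColumns E).card : ℝ) = k at *
  generalize (D : ℝ) = D' at *
  generalize (Nat.card G : ℝ) = g at *
  generalize (n : ℝ) = ν at *
  -- The period is at most |G|, so that the even splitting also bounds the number of rounds by a
  -- multiple of D.
  have hdN : d * N ≤ a * D' := by nlinarith
  have e1 : (D' + d * N) * (k * (2 * N + 1)) ≤ (1 + a) * D' * (k * (3 * N)) := by
    apply mul_le_mul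
    · linarith
    · exact mul_le_mul_of_nonneg_left (by linarith) (by linarith)
    · exact mul_nonneg (by linarith) (by linarith)
    · exact mul_nonneg (by linarith) (by linarith)
  have e2 : (2 * N + ν * N) * (2 * N + 1) ≤ ((ν + 1) * (2 * N)) * (3 * N) := by
    apply mul_le_mul
    · nlinarith
    · linarith
    · linarith
    · exact mul_nonneg (by linarith) (by linarith)
  have e3 : (ν + 1) * N ^ 2 ≤ (ν + 1) * (k * (N * D')) := by
    apply mul_le_mul_of_nonneg_left _ (by linarith)
    have : N * N ≤ N * D' := mul_le_mul_of_nonneg_left hND (by linarith)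
    nlinarith
  have e4 : (1 + a) * D' * (k * (3 * N)) ≤ (3 + 3 * a) * ((ν + 1) * (k * (N * D'))) := by
    have h5 : 0 ≤ k * (N * D') := mul_nonneg (by linarith) (mul_nonneg (by linarith) (by linarith))
    have h6 : k * (N * D') ≤ (ν + 1) * (k * (N * D')) := by nlinarith
    nlinarith
  have e5 : (m : ℝ) ≤ (69 + 3 * a) * ((ν + 1) * (k * (N * D'))) := by
    have : (m : ℝ) ≤ (3 + 3 * a) * ((ν + 1) * (k * (N * D'))) + 66 * ((ν + 1) * N ^ 2) := by
      linarith
    linarith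
  have e6 : N ≤ a * D' / g := by rwa [le_div_iff₀ hg]
  refine e5.trans ?_
  have e7 : (ν + 1) * (k * (N * D')) ≤ (ν + 1) * (k * (a * D' / g * D')) := by
    apply mul_le_mul_of_nonneg_left _ (by linarith)
    apply mul_le_mul_of_nonneg_left _ (by linarith)
    exact mul_le_mul_of_nonneg_right e6 (by linarith)
  calc (69 + 3 * a) * ((ν + 1) * (k * (N * D')))
      ≤ (69 + 3 * a) * ((ν + 1) * (k * (a * D' / g * D'))) :=
        mul_le_mul_of_nonneg_left e7 (by linarith)
    _ = _ := by ring

end ShapeSetting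

end

/-! ### Assembly of the algorithm and its guarantees -/

theorem mainTheorem4 (c : ℝ) :
    ∃ C : ℝ, ∀ (n D : ℕ) (E : Finset (Fin (n + 1) →₀ ℕ))
      (R : (Fin (n + 1) →₀ ℕ) → (Fin (n + 1) →₀ ℕ) → Prop),
      ∃ alg : TableAlgorithm (n + 1) D E,
        ∀ (K : Type*) [Field K] (G : Subgroup (GL (Fin (n + 1)) K)) [Finite G]
          (I : Ideal (MvPolynomial (Fin (n + 1)) K))
          (𝒢 ℋ : Set (MvPolynomial (Fin (n + 1)) K)),
          (∀ A ∈ G, (A : Matrix (Fin (n + 1)) (Fin (n + 1)) K).IsDiag) →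
          (∀ s t, SameGDegree G s t ↔ R s t) →
          IsZeroDimensional I →
          idealDegree I = D →
          IsInvariantUnder I G →
          IsReducedGroebnerBasis (drl (n + 1)) I 𝒢 →
          IsReducedGroebnerBasis MonomialOrder.lex I ℋ →
          PropertyS D ℋ →
          PropertyM 𝒢 →
          staircase (drl (n + 1)) 𝒢 = (E : Set (Fin (n + 1) →₀ ℕ)) →
          ((staircase MonomialOrder.lex ℋ ∩ degreeZeroMonomials G).ncard : ℝ)
              * (Nat.card G : ℝ) ≤ c * (D : ℝ) →
          alg.terms.card ≤
              ((staircase MonomialOrder.lex ℋ ∩ degreeZeroMonomials G) +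
                ((staircase MonomialOrder.lex ℋ ∩ degreeZeroMonomials G) ∪
                  leadingMonomials MonomialOrder.lex ℋ)).ncard ∧
          (alg.cost : ℝ) ≤
              C * (((n : ℝ) + 1) * ((nontrivialColumns E).card : ℝ) * (D : ℝ) ^ 2
                / (Nat.card G : ℝ)) ∧
          ∃ F : MvPolynomial E K, F.totalDegree ≤ D ∧
            (∃ r : E → K, MvPolynomial.eval r F ≠ 0) ∧
            ∀ r : E → K, ∃ u : (Fin (n + 1) →₀ ℕ) → K,
              IsTableOf 𝒢 E r u ∧
              (∀ q : alg.terms, alg.tablePart.run (tableInput 𝒢 E r) q = u q) ∧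
              (MvPolynomial.eval r F ≠ 0 →
                shapeBasis D (fun i j => alg.guessPart.run (fun q : alg.terms => u q) (i, j))
                  = ℋ) := by
  -- The absolute value replaces `c`, which may have any sign, because `cost_le` needs a nonnegative
  -- constant.
  refine ⟨(69 + 3 * |c|) * |c|, fun n D E R => ?_⟩
  -- Both programs are fixed here, from the combinatorial data alone, before the field, the group
  -- and the ideal are introduced.
  obtain ⟨p, hp, hp'⟩ := computes_tableOutput D E R
  obtain ⟨q, hq, hq'⟩ := computes_guessOutput n D R
  refine ⟨⟨usedTerms n D R, p, q⟩, ?_⟩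
  intro K _ G _ I 𝒢 ℋ hdiag hR hzero hdeg hinv hdrl hlex hS hM hE hsplit
  obtain ⟨a, rfl⟩ := hS
  have S : ShapeSetting E R G I 𝒢 a :=
    ⟨inferInstance, hdiag, hR, hzero, hdeg, hinv, hdrl, hlex, hM, hE⟩
  rw [S.ncard_degreeZero] at hsplit
  refine ⟨S.card_usedTerms_le_ncard, ?_, S.hankelDet, S.totalDegree_hankelDet_le,
    S.exists_eval_hankelDet_ne_zero, fun r => ⟨quotientTable (S.tableForm r), S.isTableOf r, ?_, ?_⟩⟩
  · exact S.cost_le (abs_nonneg c) (hsplit.trans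
      (mul_le_mul_of_nonneg_right (le_abs_self c) (Nat.cast_nonneg D))) (Nat.add_le_add hp hq)
  · intro z
    rw [hp']
    exact S.tableOutput_eq (S.isTableOf r) z
  · intro hF
    rw [hq']
    exact congrArg (shapeBasis D) (funext fun i => funext fun j =>
      S.guessOutput_eq _ ((S.eval_hankelDet_ne_zero_iff r).1 hF) i j)
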